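/- A finite hypergraph $\mathbb H=(V,E)$ consists of a finite set $V$ of hypervertices and a finite family $E$ of nonempty subsets of $V$ (the hyperedges, repetitions allowed) whose union is $V$. It is connected if its bipartite incidence graph on $V\sqcup E$ is connected, and $(d,r)$-regular if every hypervertex lies in exactly $d$ hyperedges and every hyperedge contains exactly $r$ hypervertices. A closed path of length $k\ge 1$ is a sequence $(v_1,e_1,v_2,e_2,\dots,v_k,e_k,v_1)$ such that, with indices modulo $k$, $v_i$ and $v_{i+1}$ are distinct elements of $e_i$. It has hyperedge backtracking if some hyperedge is used twice in a row. A primitive cycle is a closed path $c$ such that neither $c$ nor $c^2$ ($c$ traversed twice) has hyperedge backtracking and $c$ is not of the form $b^m$ for a closed path $b$ and $m\ge 2$; a prime cycle is a primitive cycle up to cyclic permutation. The generalized Ihara–Selberg zeta function of $\mathbb H$ is, for small $|u|$, $$\zeta_{\mathbb H}(u)=\prod_{\mathfrak p}\bigl(1-u^{|\mathfrak p|}\bigr)^{-1},$$ the product being over all prime cycles $\mathfrak p$ of $\mathbb H$, and $|\mathfrak p|$ denoting the length. The adjacency matrix $A$ of $\mathbb H$ is indexed by $V$; $A_{vw}$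 is the number of hyperedges containing both $v$ and $w$ if $v\ne w$, and $A_{vv}=0$. A connected $(d,r)$-regular hypergraph is Ramanujan (in the sense of Li and Solé) if $|\lambda-r+2|\le 2\sqrt{(d-1)(r-1)}$ for all non-obvious eigenvalues $\lambda\neq d(r-1)$ of $A$; here the obvious eigenvalues are $|V|-|E|$ copies of $-d$ when $|V|>|E|$, and there are none when $|V|\le |E|$ (in particular none when $d\ge r$). **Theorem.** Let $\mathbb H$ be a finite connected $(d,r)$-regular hypergraph with $d\ge r$ and $q=(d-1)(r-1)>1$; if $r=2$ (so that $\mathbb H$ is a $d$-regular multigraph), assume that this graph is not bipartite. Let $n_1=|V|$ and $n_2=|E|$. Then the Euler product converges for small $|u|$, $\zeta_{\mathbb H}$ continues to a meromorphic function on $\mathbb C$, and the following are equivalent: 1. (modified hypergraph Riemann hypothesis) every zero $s$ with $0<\operatorname{Re}s<1$ of the meromorphic function $$\frac{\bigl(1+(r-1)q^{-s}\bigr)^{n_1-n_2}}{\zeta_{\mathbb H}(q^{-s})}$$ satisfies $\operatorname{Re}s=\tfrac12$; 2. $\mathbb H$ is Ramanujan. -/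

import Mathlib

open Filter Topology

/-- A hypergraph with finite hyperedges, on the hypervertex set `V`, whose hyperedges are indexed
by `E`.  Hyperedges may repeat (`edge` need not be injective), each hyperedge is a nonempty set of
hypervertices, and the hyperedges cover `V`. -/
structure FinHypergraph (V : Type*) (E : Type*) where
  edge : E → Finset V
  edge_nonempty : ∀ e, (edge e).Nonempty
  cover : ∀ v, ∃ e, v ∈ edge e

namespace FinHypergraph

variable {V : Type*} {E : Type*}

/-- The associated bipartite graph: its vertices are the hypervertices and the hyperedges, and
`v` is adjacent to `e` when `v` is incident to `e`. -/
def incidenceGraph (H : FinHypergraph V E) : SimpleGraph (V ⊕ E) :=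
  SimpleGraph.fromRel fun x y => ∃ v e, x = Sum.inl v ∧ y = Sum.inr e ∧ v ∈ H.edge e

/-- A hypergraph is connected when its associated bipartite graph is connected. -/
def Connected (H : FinHypergraph V E) : Prop := H.incidenceGraph.Connected

/-- `(d, r)`-regularity: every hypervertex is incident to `d` hyperedges and every hyperedge
contains `r` hypervertices. -/
def IsRegular [Fintype E] [DecidableEq V] (H : FinHypergraph V E) (d r : ℕ) : Prop :=
  (∀ v, (Finset.univ.filter fun e => v ∈ H.edge e).card = d) ∧ ∀ e, (H.edge e).card = r

/-- There is a 2-colouring of the hypervertices in which any two distinct hypervertices of a common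
hyperedge get different colours.  When all hyperedges have order 2, that is, when the hypergraph is
a (multi)graph, this says that the graph is bipartite. -/
def IsBipartite (H : FinHypergraph V E) : Prop :=
  ∃ f : V → Bool, ∀ e, ∀ v ∈ H.edge e, ∀ w ∈ H.edge e, v ≠ w → f v ≠ f w

/-! ### Prime cycles -/

/-- A closed path `(v₁, e₁, v₂, e₂, …, v_k, e_k, v₁)`, `k ≥ 1`, stored as the list
`[(v₁, e₁), …, (v_k, e_k)]`: with indices modulo `k`, the hyperedge `eᵢ` contains the two distinct
hypervertices `vᵢ` and `vᵢ₊₁`.  Its length is `k`, the length of the list. -/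
def IsClosedPath (H : FinHypergraph V E) (c : List (V × E)) : Prop :=
  c ≠ [] ∧
    Cycle.Chain (fun x y : V × E => x.1 ∈ H.edge x.2 ∧ y.1 ∈ H.edge x.2 ∧ x.1 ≠ y.1)
      (c : Cycle (V × E))

/-- No hyperedge backtracking: no subsequence `(e, v, e)`, i.e. no hyperedge is used twice in a
row. -/
def NoBacktracking (c : List (V × E)) : Prop :=
  c.IsChain fun x y => x.2 ≠ y.2

/-- The `m`-multiple `c^m` of a closed path, going around it `m` times. -/
def multiple (m : ℕ) (c : List (V × E)) : List (V × E) := (List.replicate m c).flatten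

/-- `c` is a primitive cycle: a closed path without hyperedge backtracking, which is tail-less
(`c²` has no hyperedge backtracking), and which is not a nontrivial multiple of another closed
path. -/
def IsPrimitiveCycle (H : FinHypergraph V E) (c : List (V × E)) : Prop :=
  H.IsClosedPath c ∧ NoBacktracking c ∧ NoBacktracking (multiple 2 c) ∧
    ∀ (b : List (V × E)) (m : ℕ), H.IsClosedPath b → 2 ≤ m → c ≠ multiple m b

/-- Prime cycles: primitive cycles up to cyclic permutation (a `Cycle` is a list up to
rotation). -/
def PrimeCycle (H : FinHypergraph V E) : Type _ :=
  {p : Cycle (V × E) // ∃ c : List (V × E), H.IsPrimitiveCycle c ∧ (c : Cycle (V × E)) = p}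

/-- The length of a prime cycle. -/
def PrimeCycle.length {H : FinHypergraph V E} (p : H.PrimeCycle) : ℕ := p.1.length

/-! ### The zeta function -/

/-- `Z` is the generalized Ihara–Selberg zeta function of `H`: it is meromorphic on `ℂ`, and for
all `u` with `|u|` sufficiently small the Euler product of `(1 - u ^ |p|)⁻¹` over the prime cycles
`p` of `H` converges (unconditionally) to `Z u`. -/
def IsZeta (H : FinHypergraph V E) (Z : ℂ → ℂ) : Prop :=
  Meromorphic Z ∧
    ∀ᶠ u : ℂ in 𝓝 0, HasProd (fun p : H.PrimeCycle => (1 - u ^ p.length)⁻¹) (Z u)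

/-- The modified hypergraph Riemann hypothesis for `Z (q ^ (-s))`, where `q = (d-1)(r-1)`,
`n₁ = |V|`, `n₂ = |E|`: every zero `s`, with `0 < Re s < 1`, of the meromorphic function
`(1 + (r-1) q^(-s)) ^ (n₁ - n₂) / Z (q^(-s))` has `Re s = 1/2`.  A zero of a meromorphic function is
a point at which its order is positive (so removable singularities are taken into account). -/
def ModifiedRH [Fintype V] [Fintype E] (_H : FinHypergraph V E) (d r : ℕ) (Z : ℂ → ℂ) : Prop :=
  ∀ s : ℂ, 0 < s.re → s.re < 1 →
    0 < meromorphicOrderAt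
      (fun z : ℂ =>
        (1 + ((r : ℂ) - 1) * (((d - 1) * (r - 1) : ℕ) : ℂ) ^ (-z)) ^
            ((Fintype.card V : ℤ) - (Fintype.card E : ℤ)) /
          Z ((((d - 1) * (r - 1) : ℕ) : ℂ) ^ (-z))) s →
    s.re = 1 / 2

/-! ### The Ramanujan condition -/

/-- The adjacency matrix: the `(v, w)` entry is the number of non-backtracking paths `v, e, w` of
length 2 in the associated bipartite graph.  Such a path is non-backtracking exactly when
`v ≠ w`. -/
def adjMatrix [Fintype E] [DecidableEq V] (H : FinHypergraph V E) : Matrix V V ℝ :=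
  Matrix.of fun v w =>
    if v = w then 0 else ((Finset.univ.filter fun e => v ∈ H.edge e ∧ w ∈ H.edge e).card : ℝ)

/-- The multiplicity with which `x` occurs among the obvious eigenvalues of a `(d, r)`-regular
hypergraph: the obvious eigenvalue is `-d`, with multiplicity `|V| - |E|` if this is positive
(natural-number subtraction), and there is none otherwise. -/
noncomputable def obviousMultiplicity [Fintype V] [Fintype E] (_H : FinHypergraph V E) (d : ℕ)
    (x : ℝ) : ℕ :=
  open Classical in if x = -(d : ℝ) then Fintype.card V - Fintype.card E else 0

/-- `x` is a non-obvious eigenvalue: its multiplicity in the spectrum of the adjacency matrix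
exceeds the one coming from the obvious eigenvalues. -/
def IsNonObviousEigenvalue [Fintype V] [Fintype E] [DecidableEq V] (H : FinHypergraph V E)
    (d : ℕ) (x : ℝ) : Prop :=
  H.obviousMultiplicity d x < H.adjMatrix.charpoly.rootMultiplicity x

/-- The Ramanujan condition of Li and Solé for a finite connected `(d, r)`-regular hypergraph. -/
def IsRamanujan [Fintype V] [Fintype E] [DecidableEq V] (H : FinHypergraph V E) (d r : ℕ) :
    Prop :=
  ∀ x : ℝ, H.IsNonObviousEigenvalue d x → x ≠ (d : ℝ) * ((r : ℝ) - 1) →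
    |x - (r : ℝ) + 2| ≤ 2 * Real.sqrt (((d : ℝ) - 1) * ((r : ℝ) - 1))

end FinHypergraph

/-!
# The Riemann hypothesis for the zeta function of a regular hypergraph

A prime cycle is a rotation class of primitive closed walks in the finite directed graph on pairs
`(v, e)` whose arrows are the moves `(v, e) → (w, f)` with `v ≠ w` in `e` and `e ≠ f`
(`FinHypergraph.Step`). For any finite directed graph with adjacency matrix `T`, unique
factorization of closed words as powers of primitive ones turns the Euler product into
`exp (∑ tr (T ^ k) u ^ k / k) = 1 / det (1 - u T)`
(`CyclicWord.multipleWord_bijective`, `CyclicWord.eventually_hasProd_primeClass`).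

Only flags (`v ∈ e`) matter for the determinant, and on flags `T = (J_E - 1) (J_V - 1)`, where
`J_E` and `J_V` are the matrices of the relations "same hyperedge" and "same hypervertex". Both
factor through smaller incidence matrices, so the determinant reduces to one of size `n₁ = |V|`
(`Matrix.det_one_sub_smul_flag`): with `N` the number of flags and `n₂ = |E|`,
`1 / ζ(u) = (1 - u) ^ (N - n₁ - n₂) (1 + (r - 1) u) ^ (n₂ - n₁) det (1 - (A - r + 2) u + q u²)`.
This gives the meromorphic continuation, and the identity theorem shows that every continuation
agrees with it outside a discrete set (`FinHypergraph.IsZeta.eventuallyEq`).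

The factor `(1 + (r - 1) u) ^ (n₁ - n₂)` cancels, and `1 - u` has no zero for `u = q ^ (-s)` with
`0 < Re s`. So the Riemann hypothesis says that the roots of the polynomials `1 - m u + q u²`, with
`m = t - r + 2` and `t` an eigenvalue of `A`, that lie in the annulus `1 / q < |u| < 1` have
absolute value `q ^ (-1/2)`. As `m` is real, this is automatic if `|m| ≤ 2 √q`, and false if
`2 √q < |m| < q + 1`. The eigenvalue `t = d (r - 1)` has `m = q + 1` and roots `1` and `1 / q`,
outside the annulus; all others satisfy `|m| < q + 1`
(`FinHypergraph.abs_lt_of_isRoot_charpoly`), for which `d ≥ r` and, if `r = 2`, non-bipartiteness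
are needed. Moreover `d ≥ r` forces `n₁ ≤ n₂`, so that there are no obvious eigenvalues.
-/

/-! ### Primitive words and the Euler product over prime classes -/

namespace CyclicWord

variable {X : Type*}

/-- The sequence `w w w …` obtained by repeating a word `w` periodically. It takes values in
`Option X` so that it is defined (constantly `none`) for the empty word too. -/
def periodicSeq (w : List X) (j : ℕ) : Option X := w[j % w.length]?

/-- The left shift on sequences. -/
def shift {Y : Type*} (s : ℕ → Y) (j : ℕ) : Y := s (j + 1)

theorem shift_iterate {Y : Type*} (s : ℕ → Y) (i j : ℕ) : shift^[i] s j = s (j + i) := by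
  induction i generalizing j with
  | zero => rfl
  | succ i ih => rw [Function.iterate_succ_apply', shift, ih]; congr 1; omega

theorem periodicSeq_of_lt {w : List X} {j : ℕ} (hj : j < w.length) : periodicSeq w j = w[j]? := by
  rw [periodicSeq, Nat.mod_eq_of_lt hj]

theorem isPeriodicPt_periodicSeq (w : List X) :
    Function.IsPeriodicPt shift w.length (periodicSeq w) := by
  funext j
  rw [shift_iterate, periodicSeq, Nat.add_mod_right, periodicSeq]

/-- The least period of the sequence `w w w …`: for nonempty `w`, the length of the shortest word
of which `w` is a multiple. -/
noncomputable def period (w : List X) : ℕ := Function.minimalPeriod shift (periodicSeq w)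

theorem period_dvd (w : List X) : period w ∣ w.length :=
  (isPeriodicPt_periodicSeq w).minimalPeriod_dvd

theorem period_pos {w : List X} (hc : w ≠ []) : 0 < period w :=
  (isPeriodicPt_periodicSeq w).minimalPeriod_pos (List.length_pos_iff.2 hc)

theorem periodicSeq_mod_period (w : List X) (j : ℕ) :
    periodicSeq w (j % period w) = periodicSeq w j := by
  have h := congrFun
    (Function.iterate_mod_minimalPeriod_eq (f := shift) (x := periodicSeq w) (n := j)) 0
  simpa [shift_iterate, period] using h

theorem ext_periodicSeq {w w' : List X} (hl : w.length = w'.length)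
    (hs : periodicSeq w = periodicSeq w') : w = w' := by
  apply List.ext_getElem?
  intro i
  by_cases hi : i < w.length
  · rw [← periodicSeq_of_lt hi, hs, periodicSeq_of_lt (hl ▸ hi)]
  · rw [List.getElem?_eq_none (by omega), List.getElem?_eq_none (by omega)]

theorem periodicSeq_rotate {w : List X} (hc : w ≠ []) (i : ℕ) :
    periodicSeq (w.rotate i) = shift^[i] (periodicSeq w) := by
  funext j
  have hpos := List.length_pos_iff.2 hc
  rw [shift_iterate, periodicSeq, List.length_rotate,
    List.getElem?_rotate (Nat.mod_lt _ hpos), Nat.mod_add_mod, periodicSeq]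

theorem period_rotate {w : List X} (hc : w ≠ []) (i : ℕ) : period (w.rotate i) = period w := by
  rw [period, periodicSeq_rotate hc]
  exact Function.minimalPeriod_apply_iterate
    (Function.mk_mem_periodicPts (List.length_pos_iff.2 hc) (isPeriodicPt_periodicSeq w)) i

theorem length_multiple (m : ℕ) (w : List (X)) :
    ((List.replicate m w).flatten).length = m * w.length := by
  simp

theorem getElem?_flatten_replicate (m : ℕ) (w : List X) {j : ℕ} (hj : j < m * w.length) :
    ((List.replicate m w).flatten)[j]? = w[j % w.length]? := by
  induction m generalizing j with
  | zero => simp at hj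
  | succ m ih =>
    rw [List.replicate_succ, List.flatten_cons, List.getElem?_append]
    split_ifs with h
    · rw [Nat.mod_eq_of_lt h]
    · rw [Nat.succ_mul] at hj
      rw [ih (by omega), ← Nat.mod_eq_sub_mod (by omega)]

theorem periodicSeq_flatten_replicate {m : ℕ} (hm : m ≠ 0) {w : List X} (hc : w ≠ []) :
    periodicSeq ((List.replicate m w).flatten) = periodicSeq w := by
  funext j
  have hpos : 0 < m * w.length := Nat.mul_pos (Nat.pos_of_ne_zero hm) (List.length_pos_iff.2 hc)
  rw [periodicSeq, length_multiple, getElem?_flatten_replicate _ _ (Nat.mod_lt _ hpos),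
    Nat.mod_mul_left_mod, periodicSeq]

theorem length_take_period {w : List X} (hc : w ≠ []) : (w.take (period w)).length = period w := by
  rw [List.length_take, min_eq_left (Nat.le_of_dvd (List.length_pos_iff.2 hc) (period_dvd w))]

theorem take_period_ne_nil {w : List X} (hc : w ≠ []) : w.take (period w) ≠ [] := by
  rw [← List.length_pos_iff, length_take_period hc]
  exact period_pos hc

theorem periodicSeq_take_period {w : List X} (hc : w ≠ []) :
    periodicSeq (w.take (period w)) = periodicSeq w := by
  funext j
  have hlt : j % period w < period w := Nat.mod_lt _ (period_pos hc)
  rw [periodicSeq, length_take_period hc, List.getElem?_take_of_lt hlt,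
    ← periodicSeq_mod_period w j, periodicSeq_of_lt (hlt.trans_le
      (Nat.le_of_dvd (List.length_pos_iff.2 hc) (period_dvd w)))]

/-- Every nonempty word is a multiple of the word formed by its first `period w` letters. -/
theorem eq_flatten_replicate_take_period {w : List X} (hc : w ≠ []) :
    w = (List.replicate (w.length / period w) (w.take (period w))).flatten := by
  have hm : w.length / period w ≠ 0 :=
    (Nat.div_pos (Nat.le_of_dvd (List.length_pos_iff.2 hc) (period_dvd w)) (period_pos hc)).ne'
  refine ext_periodicSeq ?_ ?_
  · rw [length_multiple, length_take_period hc, Nat.div_mul_cancel (period_dvd w)]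
  · rw [periodicSeq_flatten_replicate hm (take_period_ne_nil hc), periodicSeq_take_period hc]

theorem period_eq_length_iff {w : List X} (hc : w ≠ []) :
    period w = w.length ↔
      ∀ (b : List X) (m : ℕ), b ≠ [] → 2 ≤ m → w ≠ (List.replicate m b).flatten := by
  constructor
  · intro h b m hb hm hcb
    have h1 : period w = period b := by
      rw [period, period, hcb, periodicSeq_flatten_replicate (by omega) hb]
    have h2 : w.length = m * b.length := by rw [hcb, length_multiple]
    have h3 : period b ≤ b.length := Nat.le_of_dvd (List.length_pos_iff.2 hb) (period_dvd b)
    have h4 := List.length_pos_iff.2 hb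
    nlinarith
  · intro h
    by_contra hne
    refine h (w.take (period w)) (w.length / period w) (take_period_ne_nil hc) ?_
      (eq_flatten_replicate_take_period hc)
    obtain ⟨k, hk⟩ := period_dvd w
    have hp := period_pos hc
    rw [hk, Nat.mul_div_cancel_left _ hp]
    have hl := List.length_pos_iff.2 hc
    rcases k with _ | _ | k
    · simp at hk; exact absurd hk hc
    · simp at hk; exact absurd hk.symm hne
    · omega

/-- Cyclic admissibility of a word depends only on its periodic sequence. -/
theorem chain_iff_periodicSeq (R : X → X → Prop) (w : List X) :
    Cycle.Chain R (w : Cycle X) ↔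
      ∀ j, ∀ x ∈ periodicSeq w j, ∀ y ∈ periodicSeq w (j + 1), R x y := by
  rcases w with _ | ⟨a, l⟩
  · simp [periodicSeq]
  have key : ∀ i ≤ l.length + 1, (a :: (l ++ [a]))[i]? = periodicSeq (a :: l) i := by
    intro i hi
    rcases hi.lt_or_eq with h | rfl
    · rw [periodicSeq_of_lt (by simpa using h), ← List.cons_append,
        List.getElem?_append_left (by simpa using h)]
    · simp [periodicSeq]
  rw [Cycle.chain_coe_cons, List.isChain_iff_getElem]
  constructor
  · intro h j x hx y hy
    have hlt : j % (a :: l).length < l.length + 1 := by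
      simpa using Nat.mod_lt j (Nat.succ_pos l.length)
    have e1 : periodicSeq (a :: l) j = periodicSeq (a :: l) (j % (a :: l).length) := by
      simp [periodicSeq]
    have e2 : periodicSeq (a :: l) (j + 1) = periodicSeq (a :: l) (j % (a :: l).length + 1) := by
      simp [periodicSeq]
    have h' := h (j % (a :: l).length) (by simp at hlt ⊢; omega)
    rw [e1, ← key _ hlt.le, Option.mem_def, List.getElem?_eq_some_iff] at hx
    rw [e2, ← key _ hlt, Option.mem_def, List.getElem?_eq_some_iff] at hy
    obtain ⟨_, rfl⟩ := hx
    obtain ⟨_, rfl⟩ := hy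
    exact h'
  · intro h i hi
    have hi' : i + 1 ≤ l.length + 1 := by simp at hi; omega
    refine h i _ ?_ _ ?_
    · rw [← key i (by omega), Option.mem_def, List.getElem?_eq_some_iff]
      exact ⟨by omega, rfl⟩
    · rw [← key _ hi', Option.mem_def, List.getElem?_eq_some_iff]
      exact ⟨hi, rfl⟩

theorem chain_congr {R : X → X → Prop} {w w' : List X} (h : periodicSeq w = periodicSeq w') :
    Cycle.Chain R (w : Cycle X) ↔ Cycle.Chain R (w' : Cycle X) := by
  rw [chain_iff_periodicSeq, chain_iff_periodicSeq, h]

variable (R : X → X → Prop)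

/-- Nonempty words whose cyclically consecutive letters are related by `R`, i.e. closed walks (with
a starting point) in the directed graph `R`. -/
def ClosedWord : Type _ := {w : List X // w ≠ [] ∧ Cycle.Chain R (w : Cycle X)}

/-- Closed words which are not multiples of shorter words. -/
def PrimitiveWord : Type _ :=
  {w : List X // (w ≠ [] ∧ Cycle.Chain R (w : Cycle X)) ∧ period w = w.length}

/-- Primitive closed words up to rotation. -/
def PrimeClass : Type _ :=
  {p : Cycle X // ∃ w : List X,
    ((w ≠ [] ∧ Cycle.Chain R (w : Cycle X)) ∧ period w = w.length) ∧ (w : Cycle X) = p}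

variable {R}

/-- The multiple `b ^ (m + 1)` of a primitive word, as a closed word. -/
def multipleWord (b : PrimitiveWord R × ℕ) : ClosedWord R :=
  ⟨(List.replicate (b.2 + 1) b.1.1).flatten, by
    have h := b.1.2.1.1
    rw [← List.length_pos_iff, length_multiple]
    exact Nat.mul_pos b.2.succ_pos (List.length_pos_iff.2 h),
    (chain_congr (periodicSeq_flatten_replicate b.2.succ_ne_zero b.1.2.1.1)).2 b.1.2.1.2⟩

theorem length_multipleWord (b : PrimitiveWord R × ℕ) :
    (multipleWord b).1.length = (b.2 + 1) * b.1.1.length :=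
  length_multiple _ _

/-- Unique factorization: a closed word is a multiple of exactly one primitive word, with exactly
one exponent. -/
theorem multipleWord_bijective : Function.Bijective (multipleWord (R := R)) := by
  constructor
  · rintro ⟨⟨b, hb⟩, m⟩ ⟨⟨b', hb'⟩, m'⟩ h
    have h0 : (List.replicate (m + 1) b).flatten = (List.replicate (m' + 1) b').flatten :=
      congrArg Subtype.val h
    have hs : periodicSeq b = periodicSeq b' := by
      rw [← periodicSeq_flatten_replicate m.succ_ne_zero hb.1.1, h0,
        periodicSeq_flatten_replicate m'.succ_ne_zero hb'.1.1]
    have hl : b.length = b'.length := by rw [← hb.2, ← hb'.2, period, period, hs]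
    obtain rfl := ext_periodicSeq hl hs
    have h1 := congrArg List.length h0
    rw [length_multiple, length_multiple] at h1
    have := Nat.eq_of_mul_eq_mul_right (List.length_pos_iff.2 hb.1.1) h1
    obtain rfl : m = m' := by omega
    rfl
  · rintro ⟨w, hc, hR⟩
    have hs := periodicSeq_take_period hc
    refine ⟨⟨⟨w.take (period w), ⟨take_period_ne_nil hc, (chain_congr hs).2 hR⟩, ?_⟩,
      w.length / period w - 1⟩, Subtype.ext ?_⟩
    · rw [length_take_period hc, period, hs, period]
    · have hm : 0 < w.length / period w :=
        Nat.div_pos (Nat.le_of_dvd (List.length_pos_iff.2 hc) (period_dvd w)) (period_pos hc)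
      change (List.replicate (w.length / period w - 1 + 1) _).flatten = w
      rw [Nat.sub_add_cancel hm]
      exact (eq_flatten_replicate_take_period hc).symm

/-- The rotation class of a primitive word. -/
def toPrimeClass (b : PrimitiveWord R) : PrimeClass R := ⟨(b.1 : Cycle X), b.1, b.2, rfl⟩

/-- A rotation class of primitive words of length `n` consists of exactly `n` words. -/
theorem exists_fiber_equiv (p : PrimeClass R) :
    Nonempty (Fin p.1.length ≃ {b : PrimitiveWord R // toPrimeClass b = p}) := by
  obtain ⟨p, w, hc, rfl⟩ := p
  have hne := hc.1.1
  have hrot : ∀ i : ℕ, ((w.rotate i ≠ [] ∧ Cycle.Chain R (w.rotate i : Cycle X)) ∧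
      period (w.rotate i) = (w.rotate i).length) := by
    intro i
    have hcyc : (w.rotate i : Cycle X) = (w : Cycle X) :=
      Cycle.coe_eq_coe.2 (List.IsRotated.forall w i)
    refine ⟨⟨by simpa [List.rotate_eq_nil_iff] using hne, by rw [hcyc]; exact hc.1.2⟩, ?_⟩
    rw [period_rotate hne, List.length_rotate, hc.2]
  refine ⟨Equiv.ofBijective (fun i : Fin w.length => ⟨⟨w.rotate i, hrot i⟩,
    Subtype.ext (Cycle.coe_eq_coe.2 (List.IsRotated.forall w i))⟩) ⟨?_, ?_⟩⟩
  · intro i j hij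
    have h0 : w.rotate i = w.rotate j := congrArg (fun b => b.1.1) hij
    have h1 := congrArg periodicSeq h0
    rw [periodicSeq_rotate hne, periodicSeq_rotate hne] at h1
    have hlen : Function.minimalPeriod shift (periodicSeq w) = w.length := hc.2
    exact Fin.ext (Function.iterate_injOn_Iio_minimalPeriod (by simpa [hlen] using i.2)
      (by simpa [hlen] using j.2) h1)
  · rintro ⟨⟨b, hb⟩, hbp⟩
    have h0 : (b : Cycle X) = (w : Cycle X) := congrArg Subtype.val hbp
    obtain ⟨n, hn, rfl⟩ := List.isRotated_iff_mod.1 (Cycle.coe_eq_coe.1 h0).symm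
    refine ⟨⟨n % w.length, Nat.mod_lt _ (List.length_pos_iff.2 hne)⟩, ?_⟩
    apply Subtype.ext
    apply Subtype.ext
    exact List.rotate_mod w n

/-- The Euler product over primitive closed words up to rotation is the exponential of the
generating series `∑ u ^ |w| / |w|` of all closed words `w`: writing `w = b ^ m` with `b` primitive,
the powers of the `|b|` rotations of `b` contribute `∑ u ^ (m |b|) / m = -log (1 - u ^ |b|)`. -/
theorem hasProd_primeClass {u S : ℂ} (hu : ‖u‖ < 1)
    (hS : HasSum (fun w : ClosedWord R => u ^ w.1.length / w.1.length) S) :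
    HasProd (fun p : PrimeClass R => (1 - u ^ p.1.length)⁻¹) (Complex.exp S) := by
  have hpow : ∀ n : ℕ, n ≠ 0 → ‖u ^ n‖ < 1 := fun n hn => by
    rw [norm_pow]; exact pow_lt_one₀ (norm_nonneg _) hu hn
  have h1 := (Equiv.ofBijective _ (multipleWord_bijective (R := R))).hasSum_iff.2 hS
  have h2 : HasSum (fun b : PrimitiveWord R =>
      -Complex.log (1 - u ^ b.1.length) / b.1.length) S := by
    refine h1.prod_fiberwise fun b => ?_
    have hb : b.1.length ≠ 0 := (List.length_pos_iff.2 b.2.1.1).ne'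
    convert! (Complex.hasSum_taylorSeries_neg_log' (hpow _ hb)).div_const (b.1.length : ℂ)
      using 1
    funext m
    simp only [Function.comp_apply, Equiv.ofBijective_apply, length_multipleWord]
    have hb' : (b.1.length : ℂ) ≠ 0 := by exact_mod_cast hb
    have hm : (m : ℂ) + 1 ≠ 0 := by exact_mod_cast m.succ_ne_zero
    push_cast
    rw [mul_comm (m + 1), pow_mul]
    field_simp
  have h3 := (Equiv.sigmaFiberEquiv (toPrimeClass (R := R))).hasSum_iff.2 h2
  have h4 : HasSum (fun p : PrimeClass R => -Complex.log (1 - u ^ p.1.length)) S := by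
    -- the `|p|` rotations of a primitive word contribute equal terms
    refine h3.sigma fun p => ?_
    obtain ⟨e⟩ := exists_fiber_equiv p
    rw [← e.hasSum_iff]
    convert! hasSum_fintype _ using 1
    have hp : p.1.length ≠ 0 := by
      obtain ⟨p, w, hc, rfl⟩ := p
      exact (List.length_pos_iff.2 hc.1.1).ne'
    have hp' : (p.1.length : ℂ) ≠ 0 := by exact_mod_cast hp
    have hlen : ∀ i, ((e i).1.1).length = p.1.length := fun i =>
      congrArg (fun p' : PrimeClass R => p'.1.length) (e i).2
    simp only [Function.comp_apply, Equiv.sigmaFiberEquiv, Equiv.coe_fn_mk, hlen]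
    rw [Finset.sum_const, Finset.card_univ, Fintype.card_fin, nsmul_eq_mul]
    field_simp
  convert! h4.cexp using 1
  funext p
  have hp : p.1.length ≠ 0 := by
    obtain ⟨p, w, hw, rfl⟩ := p
    exact (List.length_pos_iff.2 hw.1.1).ne'
  have h0 : 1 - u ^ p.1.length ≠ 0 := fun h => by
    have := hpow _ hp
    rw [← sub_eq_zero.1 h] at this
    simp at this
  rw [Function.comp_apply, Complex.exp_neg, Complex.exp_log h0]

end CyclicWord

/-! ### Traces of powers and the determinant -/

section Charpoly

open Polynomial

variable {n : Type*} [Fintype n] [DecidableEq n]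

/-- The eigenvalues, with multiplicity, of `p(A)` are the values of `p` at those of `A`; here in the
form of a formula for the determinant. Both sides are multiplicative in `p`, so it suffices to treat
constants and linear polynomials. -/
theorem Matrix.det_aeval_eq_prod_roots_charpoly {K : Type*} [Field K] [IsAlgClosed K]
    (A : Matrix n n K) (p : K[X]) :
    (aeval A p).det = (A.charpoly.roots.map fun a => p.eval a).prod := by
  have hlin : ∀ b : K, (aeval A (X - C b)).det =
      (A.charpoly.roots.map fun a => (X - C b).eval a).prod := by
    intro b
    have h1 := A.eval_charpoly b
    rw [(IsAlgClosed.splits A.charpoly).eval_eq_prod_roots_of_monic A.charpoly_monic] at h1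
    have h2 : aeval A (X - C b) = -(Matrix.scalar n b - A) := by
      simp [Algebra.algebraMap_eq_smul_one, Matrix.smul_one_eq_diagonal]
    have h3 : (A.charpoly.roots.map fun a => (X - C b).eval a) =
        (A.charpoly.roots.map fun a => b - a).map Neg.neg := by
      rw [Multiset.map_map]; simp
    rw [h2, Matrix.det_neg, ← h1, h3, Multiset.prod_map_neg, Multiset.card_map,
      ← (IsAlgClosed.splits A.charpoly).natDegree_eq_card_roots, A.charpoly_natDegree_eq_dim]
  have hconst : ∀ b : K, (aeval A (C b)).det =
      (A.charpoly.roots.map fun a => (C b).eval a).prod := by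
    intro b
    rw [aeval_C, Algebra.algebraMap_eq_smul_one, Matrix.det_smul, Matrix.det_one, mul_one]
    simp [← (IsAlgClosed.splits A.charpoly).natDegree_eq_card_roots, A.charpoly_natDegree_eq_dim]
  have hmul : ∀ p q : K[X], (aeval A p).det = (A.charpoly.roots.map fun a => p.eval a).prod →
      (aeval A q).det = (A.charpoly.roots.map fun a => q.eval a).prod →
      (aeval A (p * q)).det = (A.charpoly.roots.map fun a => (p * q).eval a).prod := by
    intro p q hp hq
    rw [map_mul, Matrix.det_mul, hp, hq, ← Multiset.prod_map_mul]
    simp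
  rw [(IsAlgClosed.splits p).eq_prod_roots]
  refine hmul _ _ (hconst _) ?_
  induction p.roots using Multiset.induction_on with
  | empty => simp
  | cons b s ih =>
    rw [Multiset.map_cons, Multiset.prod_cons]
    exact hmul _ _ (hlin b) ih

theorem Matrix.roots_charpoly_pow {K : Type*} [Field K] [IsAlgClosed K] (A : Matrix n n K)
    (k : ℕ) : (A ^ k).charpoly.roots = A.charpoly.roots.map (· ^ k) := by
  have h : (A ^ k).charpoly = ((A.charpoly.roots.map (· ^ k)).map fun a => X - C a).prod := by
    refine Polynomial.funext fun t => ?_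
    have h1 := A.det_aeval_eq_prod_roots_charpoly (C t - X ^ k)
    rw [Matrix.eval_charpoly, eval_multiset_prod, Multiset.map_map, Multiset.map_map]
    simpa [Algebra.algebraMap_eq_smul_one, Matrix.smul_one_eq_diagonal] using h1
  rw [h, roots_multiset_prod_X_sub_C]

theorem Matrix.trace_pow_eq_sum_roots_charpoly {K : Type*} [Field K] [IsAlgClosed K]
    (A : Matrix n n K) (k : ℕ) : (A ^ k).trace = (A.charpoly.roots.map (· ^ k)).sum := by
  rw [Matrix.trace_eq_sum_roots_charpoly, Matrix.roots_charpoly_pow]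

theorem Matrix.det_one_sub_smul_eq_prod_roots_charpoly {K : Type*} [Field K] [IsAlgClosed K]
    (A : Matrix n n K) (u : K) :
    (1 - u • A).det = (A.charpoly.roots.map fun a => 1 - a * u).prod := by
  have h1 : aeval A (1 - C u * X) = 1 - u • A := by
    rw [map_sub, map_one, map_mul, aeval_C, aeval_X, ← Algebra.smul_def]
  rw [← h1, A.det_aeval_eq_prod_roots_charpoly]
  simp only [eval_sub, eval_one, eval_mul, eval_C, eval_X, mul_comm u]

end Charpoly

namespace Complex

theorem hasSum_sum_pow_mul_div (s : Multiset ℂ) {u : ℂ} (h : ∀ a ∈ s, ‖a * u‖ < 1) :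
    HasSum (fun k : ℕ => (s.map (· ^ k)).sum * u ^ k / k)
      (s.map fun a => -log (1 - a * u)).sum := by
  induction s using Multiset.induction_on with
  | empty => simp
  | cons a s ih =>
    have h1 := hasSum_taylorSeries_neg_log (h a (Multiset.mem_cons_self a s))
    have h2 := ih fun b hb => h b (Multiset.mem_cons_of_mem hb)
    convert! h1.add h2 using 1
    · funext k
      rw [Multiset.map_cons, Multiset.sum_cons, mul_pow]
      ring
    · rw [Multiset.map_cons, Multiset.sum_cons]

theorem exp_sum_neg_log (s : Multiset ℂ) {u : ℂ} (h : ∀ a ∈ s, ‖a * u‖ < 1) :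
    exp (s.map fun a => -log (1 - a * u)).sum = (s.map fun a => 1 - a * u).prod⁻¹ := by
  induction s using Multiset.induction_on with
  | empty => simp
  | cons a s ih =>
    have h0 : 1 - a * u ≠ 0 := fun h0 => by
      have := h a (Multiset.mem_cons_self a s)
      rw [← sub_eq_zero.1 h0] at this
      simp at this
    rw [Multiset.map_cons, Multiset.sum_cons, Multiset.map_cons, Multiset.prod_cons, exp_add,
      ih fun b hb => h b (Multiset.mem_cons_of_mem hb), exp_neg, exp_log h0, mul_inv]

/-- `exp (∑ tr (A ^ k) u ^ k / k) = 1 / det (1 - u A)`, for small `u`. -/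
theorem eventually_hasSum_trace_pow {n : Type*} [Fintype n] [DecidableEq n]
    (A : Matrix n n ℂ) :
    ∀ᶠ u : ℂ in 𝓝 0, ∃ S : ℂ, HasSum (fun k : ℕ => (A ^ k).trace * u ^ k / k) S ∧
      exp S = (1 - u • A).det⁻¹ := by
  have h : ∀ᶠ u : ℂ in 𝓝 0, ∀ a ∈ A.charpoly.roots.toFinset, ‖a * u‖ < 1 := by
    rw [eventually_all_finset]
    intro a _
    have hc : Continuous fun u : ℂ => ‖a * u‖ := by fun_prop
    exact (hc.tendsto' 0 0 (by simp)).eventually_lt_const one_pos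
  filter_upwards [h] with u hu
  simp only [Multiset.mem_toFinset] at hu
  refine ⟨_, ?_, (exp_sum_neg_log _ hu).trans ?_⟩
  · simp_rw [A.trace_pow_eq_sum_roots_charpoly]
    exact hasSum_sum_pow_mul_div _ hu
  · rw [A.det_one_sub_smul_eq_prod_roots_charpoly]

end Complex

namespace CyclicWord

variable {X : Type*}

/-- The product of the entries of `T` along the walk from `x` to `y` through the letters of the
word in between. -/
def pathWeight (T : Matrix X X ℂ) (x : X) : List X → X → ℂ
  | [], y => T x y
  | z :: w, y => T x z * pathWeight T z w y

theorem pow_succ_apply [Fintype X] [DecidableEq X] (T : Matrix X X ℂ) (k : ℕ) (x y : X) :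
    (T ^ (k + 1)) x y = ∑ f : Fin k → X, pathWeight T x (List.ofFn f) y := by
  induction k generalizing x with
  | zero => simp [pathWeight]
  | succ k ih =>
    rw [pow_succ', Matrix.mul_apply, ← (Fin.consEquiv fun _ => X).sum_comp, Fintype.sum_prod_type]
    refine Finset.sum_congr rfl fun z _ => ?_
    rw [ih, Finset.mul_sum]
    refine Finset.sum_congr rfl fun f _ => ?_
    simp [Fin.consEquiv, List.ofFn_succ, pathWeight]

open Classical in
/-- The adjacency matrix of a relation. -/
noncomputable def relMatrix (R : X → X → Prop) : Matrix X X ℂ :=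
  Matrix.of fun x y => if R x y then 1 else 0

variable (R : X → X → Prop)

open Classical in
theorem pathWeight_relMatrix (x y : X) (w : List X) :
    pathWeight (relMatrix R) x w y = if List.IsChain R (x :: (w ++ [y])) then 1 else 0 := by
  induction w generalizing x with
  | nil => simp [pathWeight, relMatrix]
  | cons z w ih =>
    rw [pathWeight, ih]
    simp only [List.cons_append, List.isChain_cons_cons, relMatrix, Matrix.of_apply]
    by_cases h : R x z <;> simp [h]

open Classical in
/-- The trace of the `k`-th power of an adjacency matrix counts the closed words of length `k`. -/
theorem trace_relMatrix_pow [Fintype X] [DecidableEq X] {k : ℕ} (hk : k ≠ 0) :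
    (relMatrix R ^ k).trace =
      ∑ f : Fin k → X, if Cycle.Chain R (List.ofFn f : Cycle X) then 1 else 0 := by
  obtain ⟨k, rfl⟩ := Nat.exists_eq_succ_of_ne_zero hk
  rw [← (Fin.consEquiv fun _ => X).sum_comp, Fintype.sum_prod_type]
  refine Finset.sum_congr rfl fun x _ => ?_
  rw [Matrix.diag_apply, pow_succ_apply]
  refine Finset.sum_congr rfl fun f _ => ?_
  rw [pathWeight_relMatrix]
  simp [Fin.consEquiv, List.ofFn_succ]

open Classical in
/-- Summing over closed words amounts to summing traces of powers of the adjacency matrix. -/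
theorem hasSum_closedWord [Fintype X] {u S : ℂ} (hu : Fintype.card X * ‖u‖ < 1)
    (hS : HasSum (fun k : ℕ => (relMatrix R ^ k).trace * u ^ k / k) S) :
    HasSum (fun w : ClosedWord R => u ^ w.1.length / w.1.length) S := by
  set F : List X → ℂ := {w | w ≠ [] ∧ Cycle.Chain R (w : Cycle X)}.indicator
    fun w => u ^ w.length / w.length with hF
  suffices h : HasSum F S from hasSum_subtype_iff_indicator.2 h
  rw [← List.equivSigmaTuple.symm.hasSum_iff]
  refine HasSum.sigma_of_hasSum hS (fun k => ?_) ?_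
  · convert! hasSum_fintype _ using 1
    rcases eq_or_ne k 0 with rfl | hk
    · simp [hF, List.equivSigmaTuple]
    rw [trace_relMatrix_pow R hk, Finset.sum_mul, Finset.sum_div]
    refine Finset.sum_congr rfl fun f _ => ?_
    have hne : List.ofFn f ≠ [] := by simpa using hk
    simp only [hF, Function.comp_apply, List.equivSigmaTuple, Equiv.coe_fn_symm_mk,
      Set.indicator_apply, Set.mem_ofPred_eq, List.length_ofFn, hne, ne_eq, not_false_eq_true,
      true_and]
    split_ifs <;> simp
  · have hbound : Summable fun p : Σ k, Fin k → X => ‖u‖ ^ p.1 := by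
      rw [summable_sigma_of_nonneg fun _ => by positivity]
      refine ⟨fun k => Summable.of_finite, ?_⟩
      have : Summable fun k : ℕ => (Fintype.card X * ‖u‖) ^ k :=
        summable_geometric_of_lt_one (by positivity) hu
      convert! this using 1
      funext k
      simp [mul_pow]
    refine Summable.of_norm_bounded hbound fun p => ?_
    simp only [hF, Function.comp_apply, List.equivSigmaTuple, Equiv.coe_fn_symm_mk,
      Set.indicator_apply, List.length_ofFn]
    split_ifs with h
    · have hp : (1 : ℝ) ≤ p.1 := by
        have : p.1 ≠ 0 := by simpa using h.1
        exact_mod_cast Nat.one_le_iff_ne_zero.2 this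
      rw [norm_div, norm_pow, Complex.norm_natCast]
      exact div_le_self (by positivity) hp
    · rw [norm_zero]; positivity

/-- The Euler product over the primitive closed words, up to rotation, of a finite directed graph
with adjacency matrix `T` is `1 / det (1 - u T)` for small `u`. -/
theorem eventually_hasProd_primeClass [Fintype X] [DecidableEq X] :
    ∀ᶠ u : ℂ in 𝓝 0, HasProd (fun p : PrimeClass R => (1 - u ^ p.1.length)⁻¹)
      (1 - u • relMatrix R).det⁻¹ := by
  have h1 : ∀ᶠ u : ℂ in 𝓝 0, ‖u‖ < 1 :=
    (continuous_norm.tendsto' 0 0 norm_zero).eventually_lt_const one_pos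
  have h2 : ∀ᶠ u : ℂ in 𝓝 0, Fintype.card X * ‖u‖ < 1 := by
    have hc : Continuous fun u : ℂ => Fintype.card X * ‖u‖ := by fun_prop
    exact (hc.tendsto' 0 0 (by simp)).eventually_lt_const one_pos
  filter_upwards [h1, h2, Complex.eventually_hasSum_trace_pow (relMatrix R)] with u hu1 hu2 h
  obtain ⟨S, hS, hexp⟩ := h
  rw [← hexp]
  refine hasProd_primeClass hu1 (hasSum_closedWord R hu2 ?_)
  convert! hS

end CyclicWord

/-! ### The flag operator and its determinant -/

/-- If `A` and `B` are the incidence matrices of the flags (rows) against the hyperedges and the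
hypervertices, then `(A Aᵀ - 1) (B Bᵀ - 1)` moves a flag to another one on the same hyperedge and
then to another one at the same hypervertex. Since `1 + u (A Aᵀ - 1)` is explicitly invertible, the
determinant of this flag operator reduces to one indexed by hypervertices. -/
theorem Matrix.det_one_sub_smul_flag {K F V E : Type*} [Field K] [Fintype F] [Fintype V]
    [Fintype E] [DecidableEq F] [DecidableEq V] [DecidableEq E]
    (A : Matrix F E K) (B : Matrix F V K) (N : Matrix V V K) (d r u : K)
    (hA : A.transpose * A = r • (1 : Matrix E E K)) (hB : B.transpose * B = d • (1 : Matrix V V K))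
    (hN : B.transpose * (A * A.transpose) * B = N + d • (1 : Matrix V V K))
    (hu : 1 - u ≠ 0) (hru : 1 + (r - 1) * u ≠ 0) :
    (1 - u) ^ (Fintype.card V + Fintype.card E) * (1 + (r - 1) * u) ^ Fintype.card V *
        (1 - u • ((A * A.transpose - 1) * (B * B.transpose - 1))).det =
      (1 - u) ^ Fintype.card F * (1 + (r - 1) * u) ^ Fintype.card E *
        ((1 + (r - 2) * u + (d - 1) * (r - 1) * u ^ 2) • (1 : Matrix V V K) - u • N).det := by
  have hru' : 1 + u * (r - 1) ≠ 0 := by rwa [mul_comm u]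
  set J : Matrix F F K := A * A.transpose with hJ
  have hJJ : J * J = r • J := by
    rw [hJ, Matrix.mul_assoc, ← Matrix.mul_assoc A.transpose, hA]
    simp
  -- `L = 1 + u (J - 1)`, with inverse `W` since `J² = r J`
  set L : Matrix F F K := (1 - u) • (1 : Matrix F F K) + u • J with hL
  set W : Matrix F F K := (1 - u)⁻¹ • ((1 : Matrix F F K) - (u / (1 + (r - 1) * u)) • J) with hW
  have hLW : L * W = 1 := by
    rw [hL, hW]
    simp only [add_mul, mul_sub, smul_mul_assoc, mul_smul_comm, one_mul, mul_one, hJJ]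
    match_scalars
    · field_simp
    · field_simp
      ring
  have hfact : 1 - u • ((J - 1) * (B * B.transpose - 1)) =
      L * (1 - ((1 - W) * B) * B.transpose) := by
    have h1 : L * ((1 - W) * B * B.transpose) = (L - 1) * (B * B.transpose) := by
      rw [Matrix.mul_assoc (1 - W), ← Matrix.mul_assoc, Matrix.mul_sub, hLW, Matrix.mul_one]
    rw [Matrix.mul_sub L, Matrix.mul_one, h1, hL, Matrix.mul_sub, Matrix.mul_one]
    have h2 : (1 - u) • (1 : Matrix F F K) + u • J - 1 = u • (J - 1) := by module
    rw [h2, smul_mul_assoc]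
    module
  have hdetL : (1 - u) ^ Fintype.card E * L.det =
      (1 - u) ^ Fintype.card F * (1 + (r - 1) * u) ^ Fintype.card E := by
    have h1 : L = (1 - u) • (1 + ((u / (1 - u)) • A) * A.transpose) := by
      rw [hL, hJ, smul_add, Matrix.smul_mul, smul_smul, mul_div_cancel₀ _ hu]
    have h2 : 1 + A.transpose * ((u / (1 - u)) • A) =
        (1 + (u / (1 - u)) * r) • (1 : Matrix E E K) := by
      rw [Matrix.mul_smul, hA]
      module
    rw [h1, Matrix.det_smul, Matrix.det_one_add_mul_comm, h2, Matrix.det_smul, Matrix.det_one,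
      mul_one, mul_left_comm, ← mul_pow]
    congr 2
    field_simp
    ring
  have hdetV : ((1 - u) * (1 + (r - 1) * u)) ^ Fintype.card V *
      (1 - B.transpose * ((1 - W) * B)).det =
      ((1 + (r - 2) * u + (d - 1) * (r - 1) * u ^ 2) • (1 : Matrix V V K) - u • N).det := by
    rw [← Matrix.det_smul]
    congr 1
    have h1 : B.transpose * ((1 - W) * B) = d • (1 : Matrix V V K) -
        (1 - u)⁻¹ • (d • (1 : Matrix V V K) -
          (u / (1 + (r - 1) * u)) • (N + d • (1 : Matrix V V K))) := by
      rw [← hN, ← hB, hW]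
      simp only [Matrix.sub_mul, Matrix.mul_sub, Matrix.smul_mul, Matrix.mul_smul, Matrix.one_mul,
        Matrix.mul_assoc]
    rw [h1]
    match_scalars
    · field_simp
      ring
    · field_simp
  rw [hfact, Matrix.det_mul, Matrix.det_one_sub_mul_comm, ← hdetV, mul_pow, ← hdetL]
  ring

namespace FinHypergraph

variable {V : Type*} {E : Type*} (H : FinHypergraph V E)

/-- One step `(v, e) → (w, f)` of a path without hyperedge backtracking. -/
def Step (x y : V × E) : Prop :=
  (x.1 ∈ H.edge x.2 ∧ y.1 ∈ H.edge x.2 ∧ x.1 ≠ y.1) ∧ x.2 ≠ y.2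

theorem noBacktracking_multiple_two_iff {c : List (V × E)} :
    NoBacktracking (multiple 2 c) ↔
      Cycle.Chain (fun x y : V × E => x.2 ≠ y.2) (c : Cycle (V × E)) := by
  rcases c with _ | ⟨a, l⟩
  · simp [NoBacktracking, multiple]
  · rw [Cycle.chain_coe_cons, ← List.cons_append]
    simp only [NoBacktracking, multiple, List.replicate_succ, List.replicate_zero,
      List.flatten_cons, List.flatten_nil, List.append_nil, List.isChain_append]
    simp

theorem noBacktracking_of_multiple_two {c : List (V × E)} (h : NoBacktracking (multiple 2 c)) :
    NoBacktracking c := by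
  simp only [NoBacktracking, multiple, List.replicate_succ, List.replicate_zero,
    List.flatten_cons, List.flatten_nil, List.append_nil, List.isChain_append] at h
  exact h.1

theorem chain_step_iff {c : List (V × E)} :
    Cycle.Chain H.Step (c : Cycle (V × E)) ↔
      Cycle.Chain (fun x y : V × E => x.1 ∈ H.edge x.2 ∧ y.1 ∈ H.edge x.2 ∧ x.1 ≠ y.1)
        (c : Cycle (V × E)) ∧
      Cycle.Chain (fun x y : V × E => x.2 ≠ y.2) (c : Cycle (V × E)) := by
  refine ⟨fun h => ⟨h.imp fun _ _ h => h.1, h.imp fun _ _ h => h.2⟩, fun h => ?_⟩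
  rw [CyclicWord.chain_iff_periodicSeq, CyclicWord.chain_iff_periodicSeq] at h
  rw [CyclicWord.chain_iff_periodicSeq]
  exact fun j x hx y hy => ⟨h.1 j x hx y hy, h.2 j x hx y hy⟩

/-- Primitive cycles of a hypergraph are the primitive closed words of the relation `Step`. -/
theorem isPrimitiveCycle_iff {c : List (V × E)} :
    H.IsPrimitiveCycle c ↔
      (c ≠ [] ∧ Cycle.Chain H.Step (c : Cycle (V × E))) ∧ CyclicWord.period c = c.length := by
  rw [chain_step_iff, ← noBacktracking_multiple_two_iff]
  constructor
  · rintro ⟨⟨hne, hc⟩, -, h2, hp⟩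
    refine ⟨⟨hne, hc, h2⟩, (CyclicWord.period_eq_length_iff hne).2 fun b m hb hm hcb => ?_⟩
    refine hp b m ⟨hb, ?_⟩ hm hcb
    rwa [hcb, CyclicWord.chain_congr
      (CyclicWord.periodicSeq_flatten_replicate (by omega) hb)] at hc
  · rintro ⟨⟨hne, hc, h2⟩, hp⟩
    exact ⟨⟨hne, hc⟩, noBacktracking_of_multiple_two h2, h2, fun b m hb hm =>
      (CyclicWord.period_eq_length_iff hne).1 hp b m hb.1 hm⟩

/-- The Euler product of a finite hypergraph is `1 / det (1 - u T)` for small `u`, where `T` is the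
matrix of the relation `Step`. -/
theorem eventually_hasProd_primeCycle [Fintype V] [Fintype E] [DecidableEq V] [DecidableEq E] :
    ∀ᶠ u : ℂ in 𝓝 0, HasProd (fun p : H.PrimeCycle => (1 - u ^ p.length)⁻¹)
      (1 - u • CyclicWord.relMatrix H.Step).det⁻¹ := by
  let e : H.PrimeCycle ≃ CyclicWord.PrimeClass H.Step :=
    Equiv.subtypeEquivRight fun p => exists_congr fun c => by rw [isPrimitiveCycle_iff]
  filter_upwards [CyclicWord.eventually_hasProd_primeClass H.Step] with u hu
  exact e.hasProd_iff.2 hu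

/-- The flags of a hypergraph: pairs of a hypervertex and a hyperedge containing it. -/
abbrev Flag : Type _ := {x : V × E // x.1 ∈ H.edge x.2}

/-- The incidence matrix of flags and hyperedges. -/
def flagEdge [DecidableEq E] : Matrix H.Flag E ℂ := Matrix.of fun f e => if f.1.2 = e then 1 else 0

/-- The incidence matrix of flags and hypervertices. -/
def flagVertex [DecidableEq V] : Matrix H.Flag V ℂ :=
  Matrix.of fun f v => if f.1.1 = v then 1 else 0

variable [Fintype E] [DecidableEq V]

/-- The incidence matrix of hypervertices and hyperedges. -/
def incMatrix (K : Type*) [Zero K] [One K] : Matrix V E K :=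
  Matrix.of fun v e => if v ∈ H.edge e then 1 else 0

theorem incMatrix_mul_transpose {H : FinHypergraph V E} {d r : ℕ} (hreg : H.IsRegular d r) :
    H.incMatrix ℝ * (H.incMatrix ℝ).transpose = H.adjMatrix + (d : ℝ) • (1 : Matrix V V ℝ) := by
  ext v w
  rw [Matrix.mul_apply]
  simp only [Matrix.transpose_apply, incMatrix, Matrix.of_apply, adjMatrix, Matrix.add_apply,
    Matrix.smul_apply, smul_eq_mul]
  rcases eq_or_ne v w with rfl | h
  · simp [← hreg.1 v, ← ite_and]
  · simp [h, ← ite_and, and_comm]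

variable [Fintype V]

/-- A sum over flags, as a sum over pairs. -/
theorem sum_flag {M : Type*} [AddCommMonoid M] (g : V → E → M) :
    ∑ f : H.Flag, g f.1.1 f.1.2 = ∑ v, ∑ e, if v ∈ H.edge e then g v e else 0 := by
  rw [← Fintype.sum_prod_type' (f := fun v e => if v ∈ H.edge e then g v e else 0),
    ← Finset.sum_filter]
  exact Finset.sum_subtype (Finset.univ.filter fun x : V × E => x.1 ∈ H.edge x.2)
    (by simp) (fun x => g x.1 x.2) |>.symm

variable {H} {d r : ℕ}

theorem flagEdge_transpose_mul [DecidableEq E] (hreg : H.IsRegular d r) :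
    H.flagEdge.transpose * H.flagEdge = (r : ℂ) • (1 : Matrix E E ℂ) := by
  ext e e'
  rw [Matrix.mul_apply]
  simp only [Matrix.transpose_apply, flagEdge, Matrix.of_apply]
  rw [H.sum_flag fun _ a => (if a = e then (1 : ℂ) else 0) * if a = e' then 1 else 0]
  rw [Finset.sum_comm, Finset.sum_eq_single e (fun b _ hb => by simp [hb]) (by simp)]
  rcases eq_or_ne e e' with rfl | h
  · simp [hreg.2 e]
  · simp [h]

theorem flagVertex_transpose_mul (hreg : H.IsRegular d r) :
    H.flagVertex.transpose * H.flagVertex = (d : ℂ) • (1 : Matrix V V ℂ) := by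
  ext v v'
  rw [Matrix.mul_apply]
  simp only [Matrix.transpose_apply, flagVertex, Matrix.of_apply]
  rw [H.sum_flag fun a _ => (if a = v then (1 : ℂ) else 0) * if a = v' then 1 else 0]
  rw [Finset.sum_eq_single v (fun b _ hb => by simp [hb]) (by simp)]
  rcases eq_or_ne v v' with rfl | h
  · simp [hreg.1 v]
  · simp [h]

theorem flagVertex_transpose_mul_flagEdge [DecidableEq E] :
    H.flagVertex.transpose * H.flagEdge = H.incMatrix ℂ := by
  ext v e
  rw [Matrix.mul_apply]
  simp only [Matrix.transpose_apply, flagVertex, flagEdge, Matrix.of_apply]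
  rw [H.sum_flag fun a b => (if a = v then (1 : ℂ) else 0) * if b = e then 1 else 0]
  rw [Finset.sum_eq_single v (fun b _ hb => by simp [hb]) (by simp),
    Finset.sum_eq_single e (fun b _ hb => by simp [hb]) (by simp)]
  simp [incMatrix]

/-- The matrix of `Step`, restricted to flags, is the product of the two flag operators. -/
theorem det_one_sub_smul_relMatrix [DecidableEq E] (u : ℂ) :
    (1 - u • CyclicWord.relMatrix H.Step).det =
      (1 - u • ((H.flagEdge * H.flagEdge.transpose - 1) *
        (H.flagVertex * H.flagVertex.transpose - 1))).det := by
  classical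
  set I : Matrix (V × E) H.Flag ℂ := Matrix.of fun x f => if x = f.1 then 1 else 0 with hI
  set T : Matrix H.Flag (V × E) ℂ := Matrix.of fun f y => if H.Step f.1 y then 1 else 0 with hT
  have h1 : u • CyclicWord.relMatrix H.Step = I * (u • T) := by
    rw [Matrix.mul_smul]
    congr 1
    ext x y
    rw [Matrix.mul_apply]
    simp only [hI, hT, CyclicWord.relMatrix, Matrix.of_apply]
    by_cases hx : x.1 ∈ H.edge x.2
    · rw [Finset.sum_eq_single ⟨x, hx⟩ (fun f _ hf => by
        have : x ≠ f.1 := fun h => hf (Subtype.ext h.symm)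
        simp [this]) (by simp)]
      simp
    · have hstep : ¬ H.Step x y := fun h => hx h.1.1
      rw [if_neg hstep]
      refine (Finset.sum_eq_zero fun f _ => ?_).symm
      have : x ≠ f.1 := fun h => hx (h ▸ f.2)
      simp [this]
  have h2 : (u • T) * I = u • ((H.flagEdge * H.flagEdge.transpose - 1) *
      (H.flagVertex * H.flagVertex.transpose - 1)) := by
    rw [Matrix.smul_mul]
    congr 1
    have hE : ∀ f g : H.Flag,
        (H.flagEdge * H.flagEdge.transpose - 1 : Matrix H.Flag H.Flag ℂ) f g =
          if f.1.2 = g.1.2 ∧ f.1.1 ≠ g.1.1 then 1 else 0 := by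
      rintro ⟨⟨v, e⟩, hf⟩ ⟨⟨w, e'⟩, hg⟩
      rw [Matrix.sub_apply, Matrix.mul_apply]
      by_cases he : e = e' <;> by_cases hv : v = w <;>
        simp [flagEdge, Matrix.one_apply, he, hv, eq_comm]
    have hV : ∀ f g : H.Flag,
        (H.flagVertex * H.flagVertex.transpose - 1 : Matrix H.Flag H.Flag ℂ) f g =
          if f.1.1 = g.1.1 ∧ f.1.2 ≠ g.1.2 then 1 else 0 := by
      rintro ⟨⟨v, e⟩, hf⟩ ⟨⟨w, e'⟩, hg⟩
      rw [Matrix.sub_apply, Matrix.mul_apply]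
      by_cases he : e = e' <;> by_cases hv : v = w <;>
        simp [flagVertex, Matrix.one_apply, he, hv, eq_comm]
    ext f g
    have hTI : (T * I) f g = if H.Step f.1 g.1 then 1 else 0 := by
      rw [Matrix.mul_apply, Finset.sum_eq_single g.1 (fun x _ hx => by simp [hI, hx]) (by simp)]
      simp [hI, hT]
    rw [hTI, Matrix.mul_apply]
    simp only [hE, hV]
    by_cases hm : g.1.1 ∈ H.edge f.1.2
    · rw [Finset.sum_eq_single ⟨(g.1.1, f.1.2), hm⟩]
      · by_cases h3 : f.1.1 = g.1.1 <;> by_cases h4 : f.1.2 = g.1.2 <;>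
          simp [Step, f.2, hm, h3, h4]
      · intro k _ hk
        by_contra hne
        apply hk
        simp only [mul_ite, mul_one, mul_zero, ite_eq_right_iff, not_forall] at hne
        obtain ⟨hk1, hk2, -⟩ := hne
        exact Subtype.ext (Prod.ext hk1.1 hk2.1.symm)
      · simp
    · rw [if_neg fun h => hm h.1.2.1]
      refine (Finset.sum_eq_zero fun k _ => ?_).symm
      by_contra hne
      simp only [mul_ite, mul_one, mul_zero, ite_eq_right_iff, not_forall] at hne
      obtain ⟨hk1, hk2, -⟩ := hne
      apply hm
      rw [← hk1.1, hk2.1]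
      exact k.2
  rw [h1, Matrix.det_one_sub_mul_comm, h2]

end FinHypergraph

/-! ### Eigenvalues of the adjacency matrix -/

theorem Matrix.exists_mulVec_eq_smul_of_isRoot_charpoly {n K : Type*} [Fintype n] [DecidableEq n]
    [Field K] {A : Matrix n n K} {t : K} (h : A.charpoly.IsRoot t) :
    ∃ x : n → K, x ≠ 0 ∧ A.mulVec x = t • x := by
  rw [Polynomial.IsRoot, Matrix.eval_charpoly] at h
  obtain ⟨x, hx, hx0⟩ := Matrix.exists_mulVec_eq_zero_iff.2 h
  refine ⟨x, hx, ?_⟩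
  rw [Matrix.sub_mulVec, sub_eq_zero] at hx0
  rw [← hx0]
  ext i
  simp [Matrix.mulVec_diagonal]

namespace FinHypergraph

variable {V : Type*} {E : Type*} {H : FinHypergraph V E}
variable [Fintype E] [DecidableEq V] {d r : ℕ}

theorem adjMatrix_isHermitian : H.adjMatrix.IsHermitian := by
  ext v w
  simp [adjMatrix, eq_comm, and_comm]

variable [Fintype V]

theorem sum_incMatrix_mul_transpose (hreg : H.IsRegular d r) (v : V) :
    ∑ w, (H.incMatrix ℝ * (H.incMatrix ℝ).transpose) v w = d * r := by
  simp only [Matrix.mul_apply, Matrix.transpose_apply, incMatrix, Matrix.of_apply]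
  rw [Finset.sum_comm]
  have h : ∀ e, ∑ w, (if v ∈ H.edge e then (1 : ℝ) else 0) * (if w ∈ H.edge e then 1 else 0) =
      if v ∈ H.edge e then (r : ℝ) else 0 := by
    intro e
    rw [← Finset.mul_sum]
    simp [hreg.2 e]
  simp only [h]
  rw [← Finset.sum_filter, Finset.sum_const, hreg.1 v, nsmul_eq_mul]

theorem sum_adjMatrix (hreg : H.IsRegular d r) (v : V) :
    ∑ w, H.adjMatrix v w = d * (r - 1) := by
  have h := sum_incMatrix_mul_transpose hreg v
  rw [incMatrix_mul_transpose hreg] at h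
  simp only [Matrix.add_apply, Finset.sum_add_distrib, Matrix.smul_apply, smul_eq_mul,
    Matrix.one_apply, mul_ite, mul_one, mul_zero, Finset.sum_ite_eq, Finset.mem_univ,
    if_true] at h
  linarith

/-- Eigenvalues are bounded by the row sums of the adjacency matrix. -/
theorem le_of_isRoot_charpoly (hreg : H.IsRegular d r) {t : ℝ}
    (ht : H.adjMatrix.charpoly.IsRoot t) : t ≤ d * (r - 1) := by
  obtain ⟨x, hx, hAx⟩ := Matrix.exists_mulVec_eq_smul_of_isRoot_charpoly ht
  obtain ⟨w, hw⟩ := Function.ne_iff.1 hx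
  have : Nonempty V := ⟨w⟩
  obtain ⟨v, hv⟩ := Finite.exists_max fun v => |x v|
  have hpos : 0 < |x v| := (abs_pos.2 hw).trans_le (hv w)
  have hnn : ∀ w, 0 ≤ H.adjMatrix v w := fun w => by
    simp only [adjMatrix, Matrix.of_apply]
    split_ifs <;> positivity
  have h1 : t * x v = ∑ w, H.adjMatrix v w * x w := by
    have := congrFun hAx v
    simp only [Matrix.mulVec, dotProduct, Pi.smul_apply, smul_eq_mul] at this
    exact this.symm
  refine le_of_mul_le_mul_right ?_ hpos
  calc t * |x v| ≤ |t| * |x v| := by gcongr; exact le_abs_self t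
    _ = |∑ w, H.adjMatrix v w * x w| := by rw [← abs_mul, h1]
    _ ≤ ∑ w, |H.adjMatrix v w * x w| := Finset.abs_sum_le_sum_abs _ _
    _ ≤ ∑ w, H.adjMatrix v w * |x v| := by
        refine Finset.sum_le_sum fun w _ => ?_
        rw [abs_mul, abs_of_nonneg (hnn w)]
        exact mul_le_mul_of_nonneg_left (hv w) (hnn w)
    _ = d * (r - 1) * |x v| := by rw [← Finset.sum_mul, sum_adjMatrix hreg]

/-- If `t` is an eigenvalue of `A = M Mᵀ - d` with eigenvector `x`, then
`(t + d) |x|² = |Mᵀ x|²`. -/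
theorem add_mul_dotProduct_self (hreg : H.IsRegular d r) {t : ℝ} {x : V → ℝ}
    (hAx : H.adjMatrix.mulVec x = t • x) :
    (t + d) * (x ⬝ᵥ x) =
      (H.incMatrix ℝ).transpose.mulVec x ⬝ᵥ (H.incMatrix ℝ).transpose.mulVec x := by
  have h : (H.incMatrix ℝ * (H.incMatrix ℝ).transpose).mulVec x = (t + d) • x := by
    rw [incMatrix_mul_transpose hreg, Matrix.add_mulVec, hAx, Matrix.smul_mulVec,
      Matrix.one_mulVec, add_smul]
  rw [← smul_eq_mul, ← dotProduct_smul, ← h, ← Matrix.mulVec_mulVec, Matrix.dotProduct_mulVec,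
    ← Matrix.mulVec_transpose]

theorem neg_le_of_isRoot_charpoly (hreg : H.IsRegular d r) {t : ℝ}
    (ht : H.adjMatrix.charpoly.IsRoot t) : -(d : ℝ) ≤ t := by
  obtain ⟨x, hx, hAx⟩ := Matrix.exists_mulVec_eq_smul_of_isRoot_charpoly ht
  have h := add_mul_dotProduct_self hreg hAx
  have hx' : 0 < x ⬝ᵥ x :=
    lt_of_le_of_ne (Finset.sum_nonneg fun i _ => mul_self_nonneg (x i))
      (Ne.symm (mt dotProduct_self_eq_zero.1 hx))
  have h2 : 0 ≤ (H.incMatrix ℝ).transpose.mulVec x ⬝ᵥ (H.incMatrix ℝ).transpose.mulVec x :=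
    Finset.sum_nonneg fun i _ => mul_self_nonneg _
  rw [← h] at h2
  have := nonneg_of_mul_nonneg_left h2 hx'
  linarith

/-- For a connected graph, `-d` is an eigenvalue only if the graph is bipartite: an eigenvector
changes sign along each edge, so the signs of its entries give a 2-colouring. -/
theorem isBipartite_of_isRoot_charpoly_neg (hconn : H.Connected) (hreg : H.IsRegular d 2)
    (ht : H.adjMatrix.charpoly.IsRoot (-(d : ℝ))) : H.IsBipartite := by
  obtain ⟨x, hx, hAx⟩ := Matrix.exists_mulVec_eq_smul_of_isRoot_charpoly ht
  have h := add_mul_dotProduct_self hreg hAx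
  rw [neg_add_cancel, zero_mul, eq_comm, dotProduct_self_eq_zero] at h
  have hsum : ∀ e, ∑ v ∈ H.edge e, x v = 0 := by
    intro e
    have := congrFun h e
    simpa [Matrix.mulVec, dotProduct, incMatrix, Finset.sum_ite_mem] using this
  have hneg : ∀ e, ∀ v ∈ H.edge e, ∀ w ∈ H.edge e, v ≠ w → x v = -x w := by
    intro e v hv w hw hvw
    have hpair : H.edge e = {v, w} := by
      refine (Finset.eq_of_subset_of_card_le ?_ ?_).symm
      · simp [Finset.insert_subset_iff, hv, hw]
      · rw [hreg.2 e, Finset.card_pair hvw]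
    have := hsum e
    rw [hpair, Finset.sum_pair hvw] at this
    linarith
  obtain ⟨v₀, hv₀⟩ := Function.ne_iff.1 hx
  -- `|x|` is constant along walks in the incidence graph
  let P : V ⊕ E → Prop := Sum.elim (fun v => |x v| = |x v₀|) fun e => ∀ v ∈ H.edge e, |x v| = |x v₀|
  have hstep : ∀ a b, H.incidenceGraph.Adj a b → P a → P b := by
    intro a b hab ha
    rw [incidenceGraph, SimpleGraph.fromRel_adj] at hab
    obtain ⟨-, ⟨v, e, rfl, rfl, hve⟩ | ⟨v, e, rfl, rfl, hve⟩⟩ := hab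
    · intro w hw
      rcases eq_or_ne w v with rfl | hwv
      · exact ha
      · rw [hneg e w hw v hve hwv, abs_neg]
        exact ha
    · exact ha v hve
  have hall : ∀ a, P a := by
    intro a
    obtain ⟨p⟩ := hconn.preconnected (Sum.inl v₀) a
    have hp : ∀ {a b : V ⊕ E}, H.incidenceGraph.Walk a b → P a → P b := by
      intro a b p
      induction p with
      | nil => exact id
      | cons hadj _ ih => exact fun ha => ih (hstep _ _ hadj ha)
    exact hp p (rfl : |x v₀| = |x v₀|)
  refine ⟨fun v => decide (0 < x v), fun e v hv w hw hvw => ?_⟩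
  have h1 : x w ≠ 0 := by
    have : |x w| = |x v₀| := hall (Sum.inl w)
    rw [← abs_pos, this, abs_pos]
    exact hv₀
  have h2 := hneg e v hv w hw hvw
  rcases lt_or_gt_of_ne h1 with h3 | h3
  · simp [h2, h3, h3.le]
  · simp [h2, h3, h3.le]

/-- The eigenvalues other than `d (r - 1)` satisfy the strict bound `|t - r + 2| < q + 1`. -/
theorem abs_lt_of_isRoot_charpoly (hconn : H.Connected) (hreg : H.IsRegular d r)
    (hdr : r ≤ d) (hq : 1 < (d - 1) * (r - 1)) (hbip : r = 2 → ¬ H.IsBipartite) {t : ℝ}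
    (ht : H.adjMatrix.charpoly.IsRoot t) (hne : t ≠ d * (r - 1)) :
    |t - r + 2| < ((d : ℝ) - 1) * (r - 1) + 1 := by
  have hr : 2 ≤ r := by
    by_contra h
    have : r - 1 = 0 := by omega
    simp [this] at hq
  have hup := lt_of_le_of_ne (le_of_isRoot_charpoly hreg ht) hne
  have hlow := neg_le_of_isRoot_charpoly hreg ht
  rw [abs_lt]
  refine ⟨?_, by nlinarith⟩
  rcases hr.eq_or_lt with rfl | hr3
  · have h1 : -(d : ℝ) ≠ t := fun h =>
      hbip rfl (isBipartite_of_isRoot_charpoly_neg hconn hreg (h ▸ ht))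
    have h2 := lt_of_le_of_ne hlow h1
    push_cast
    linarith
  · have hr' : (3 : ℝ) ≤ r := by exact_mod_cast hr3
    have hd' : (r : ℝ) ≤ d := by exact_mod_cast hdr
    nlinarith [mul_nonneg (sub_nonneg.2 hr') (sub_nonneg.2 (hr'.trans hd'))]

theorem card_flag_eq_left (hreg : H.IsRegular d r) :
    Fintype.card H.Flag = Fintype.card V * d := by
  have h := H.sum_flag fun _ _ => 1
  simpa [hreg.1] using h

theorem card_flag_eq_right (hreg : H.IsRegular d r) :
    Fintype.card H.Flag = Fintype.card E * r := by
  have h := H.sum_flag fun _ _ => 1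
  rw [Finset.sum_comm] at h
  simpa [hreg.2] using h

theorem card_le_card (hreg : H.IsRegular d r) (hdr : r ≤ d) (hr : 0 < r) :
    Fintype.card V ≤ Fintype.card E := by
  have h := (card_flag_eq_left hreg).symm.trans (card_flag_eq_right hreg)
  refine Nat.le_of_mul_le_mul_right ?_ hr
  rw [← h]
  exact Nat.mul_le_mul_left _ hdr

theorem card_add_card_le_card_flag (hreg : H.IsRegular d r) (hdr : r ≤ d) (hr : 2 ≤ r) :
    Fintype.card V + Fintype.card E ≤ Fintype.card H.Flag := by
  have h1 := card_flag_eq_left hreg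
  have h2 := card_flag_eq_right hreg
  nlinarith [Nat.mul_le_mul_left (Fintype.card V) (hr.trans hdr),
    Nat.mul_le_mul_left (Fintype.card E) hr]

/-- When `d ≥ r` there are no obvious eigenvalues, and the Ramanujan condition bears on all
eigenvalues other than `d (r - 1)`. -/
theorem isRamanujan_iff (hreg : H.IsRegular d r) (hdr : r ≤ d) (hr : 0 < r) :
    H.IsRamanujan d r ↔ ∀ t : ℝ, H.adjMatrix.charpoly.IsRoot t → t ≠ d * (r - 1) →
      |t - r + 2| ≤ 2 * Real.sqrt ((d - 1) * (r - 1)) := by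
  have h : ∀ t, H.IsNonObviousEigenvalue d t ↔ H.adjMatrix.charpoly.IsRoot t := by
    intro t
    have h0 : H.obviousMultiplicity d t = 0 := by
      simp [obviousMultiplicity, Nat.sub_eq_zero_of_le (card_le_card hreg hdr hr)]
    rw [IsNonObviousEigenvalue, h0, Polynomial.rootMultiplicity_pos
      (Matrix.charpoly_monic _).ne_zero]
  simp only [IsRamanujan, h]

end FinHypergraph

/-! ### Orders of meromorphic functions -/

theorem Complex.log_natCast_ne_zero {n : ℕ} (hn : 1 < n) : Complex.log n ≠ 0 := by
  rw [← Complex.natCast_log]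
  exact_mod_cast (Real.log_pos (by exact_mod_cast hn)).ne'

theorem AnalyticAt.meromorphicOrderAt_pos_iff {𝕜 E : Type*} [NontriviallyNormedField 𝕜]
    [NormedAddCommGroup E] [NormedSpace 𝕜 E] {f : 𝕜 → E} {x : 𝕜} (hf : AnalyticAt 𝕜 f x) :
    0 < meromorphicOrderAt f x ↔ f x = 0 := by
  rw [hf.meromorphicOrderAt_eq, ← not_iff_not, ← ne_eq, ← hf.analyticOrderAt_eq_zero]
  cases analyticOrderAt f x with
  | top => simp
  | coe n =>
    rw [ENat.map_natCast, not_lt]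
    norm_cast
    exact Nat.le_zero

/-! ### Quadratic factors and their roots -/

/-- If `|m| ≤ 2 √q`, then the roots of the real quadratic polynomial `1 - m u + q u²` are complex
conjugates of each other, or equal, hence of absolute value `q ^ (-1/2)`. -/
theorem Complex.mul_normSq_eq_one_of_quadratic {q m : ℝ} (hq : 0 < q) (hm : m ^ 2 ≤ 4 * q)
    {u : ℂ} (h : 1 - m * u + q * u ^ 2 = 0) : q * Complex.normSq u = 1 := by
  have hre := congrArg Complex.re h
  have him := congrArg Complex.im h
  simp [pow_two] at hre him
  rw [Complex.normSq_apply]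
  rcases eq_or_ne u.im 0 with h0 | h0
  · rw [h0] at hre ⊢
    have h1 : (2 * q * u.re - m) ^ 2 ≤ 0 := by nlinarith
    have h2 : 2 * q * u.re - m = 0 :=
      (pow_eq_zero_iff two_ne_zero).1 (le_antisymm h1 (sq_nonneg _))
    have h3 : m = 2 * q * u.re := by linarith
    rw [h3] at hre
    linarith
  · have h2 : m = 2 * q * u.re := by
      apply mul_right_cancel₀ h0
      linarith
    rw [h2] at hre
    linarith

/-- If `2 √q < |m| < q + 1`, then the quadratic polynomial `1 - m u + q u²` has a real root with
`q ^ (-1/2) < |u| < 1`. -/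
theorem exists_quadratic_root {q m : ℝ} (hq : 1 < q) (hm : 4 * q < m ^ 2) (hm' : |m| < q + 1) :
    ∃ a : ℝ, 1 - m * a + q * a ^ 2 = 0 ∧ 1 < q * a ^ 2 ∧ a ^ 2 < 1 := by
  -- the root is `(m + √(m² - 4q)) / 2q`, up to the symmetry `(m, u) ↦ (-m, -u)`
  wlog h0 : 0 ≤ m generalizing m
  · obtain ⟨a, h1, h2, h3⟩ := this (m := -m) (by simpa using hm) (by simpa using hm') (by linarith)
    exact ⟨-a, by linear_combination h1, by simpa using h2, by simpa using h3⟩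
  rw [abs_of_nonneg h0] at hm'
  set D := Real.sqrt (m ^ 2 - 4 * q) with hD
  have hD0 : 0 < D := Real.sqrt_pos.2 (by linarith)
  have hD2 : D ^ 2 = m ^ 2 - 4 * q := Real.sq_sqrt (by linarith)
  have hroot : 1 - m * ((m + D) / (2 * q)) + q * ((m + D) / (2 * q)) ^ 2 = 0 := by
    field_simp
    linear_combination hD2
  have hDlt : D < 2 * q - m := by
    refine lt_of_pow_lt_pow_left₀ 2 (by linarith) ?_
    rw [hD2]
    nlinarith
  have hpos : 0 < (m + D) / (2 * q) := by positivity
  have hlt : (m + D) / (2 * q) < 1 := by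
    rw [div_lt_one (by linarith)]
    linarith
  refine ⟨_, hroot, ?_, by nlinarith⟩
  have : q * ((m + D) / (2 * q)) ^ 2 = (m + D) ^ 2 / (4 * q) := by
    field_simp
    ring
  rw [this, one_lt_div (by linarith)]
  nlinarith

namespace FinHypergraph

variable {V : Type*} {E : Type*} (H : FinHypergraph V E)
variable [Fintype V] [Fintype E] [DecidableEq V]

/-! ### The zeta function as a rational function -/

/-- The determinant `det (1 - (A - r + 2) u + (d - 1) (r - 1) u²)`, where `A` is the adjacency
matrix. -/
noncomputable def adjDet (d r : ℕ) (u : ℂ) : ℂ :=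
  ((1 + ((r : ℂ) - 2) * u + ((d : ℂ) - 1) * ((r : ℂ) - 1) * u ^ 2) • (1 : Matrix V V ℂ) -
    u • H.adjMatrix.map (algebraMap ℝ ℂ)).det

theorem differentiable_adjDet (d r : ℕ) : Differentiable ℂ (H.adjDet d r) := by
  unfold adjDet
  simp only [Matrix.det_apply, Matrix.sub_apply, Matrix.smul_apply]
  fun_prop

open Polynomial in
/-- The zeros of `adjDet` are the roots of the quadratic polynomials attached to the eigenvalues,
which are real since the adjacency matrix is symmetric. -/
theorem adjDet_eq_zero_iff (d r : ℕ) (u : ℂ) :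
    H.adjDet d r u = 0 ↔ ∃ t : ℝ, H.adjMatrix.charpoly.IsRoot t ∧
      1 - ((t - r + 2 : ℝ) : ℂ) * u + (((d - 1) * (r - 1) : ℝ) : ℂ) * u ^ 2 = 0 := by
  set c : ℂ := 1 + ((r : ℂ) - 2) * u + ((d : ℂ) - 1) * ((r : ℂ) - 1) * u ^ 2 with hc
  have h1 : H.adjDet d r u =
      (aeval (H.adjMatrix.map (algebraMap ℝ ℂ)) (C c - C u * X)).det := by
    rw [map_sub, map_mul, aeval_C, aeval_C, aeval_X, ← Algebra.smul_def,
      Algebra.algebraMap_eq_smul_one, adjDet]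
  rw [h1, Matrix.det_aeval_eq_prod_roots_charpoly, Matrix.charpoly_map,
    Splits.roots_map adjMatrix_isHermitian.splits_charpoly, Multiset.map_map,
    Multiset.prod_eq_zero_iff]
  simp only [Multiset.mem_map, mem_roots (Matrix.charpoly_monic _).ne_zero]
  refine exists_congr fun t => and_congr_right fun _ => ?_
  simp only [Function.comp_apply, eval_sub, eval_C, eval_mul, eval_X, hc]
  rw [Complex.coe_algebraMap]
  push_cast
  constructor <;> intro h <;> linear_combination h

/-- The polynomial `1 / ζ(u) = (1 - u) ^ (N - n₁ - n₂) (1 + (r - 1) u) ^ (n₂ - n₁) adjDet(u)`, where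
`N`, `n₁`, `n₂` are the numbers of flags, hypervertices and hyperedges. -/
noncomputable def zetaInv (d r : ℕ) (u : ℂ) : ℂ :=
  (1 - u) ^ (Fintype.card H.Flag - (Fintype.card V + Fintype.card E)) *
    (1 + ((r : ℂ) - 1) * u) ^ (Fintype.card E - Fintype.card V) * H.adjDet d r u

theorem differentiable_zetaInv (d r : ℕ) : Differentiable ℂ (H.zetaInv d r) := by
  have := H.differentiable_adjDet d r
  unfold zetaInv
  fun_prop

variable {H} {d r : ℕ}

/-- The determinant formula. -/
theorem det_one_sub_smul_relMatrix_eq_zetaInv [DecidableEq E] (hreg : H.IsRegular d r)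
    (hdr : r ≤ d) (hr : 2 ≤ r) {u : ℂ} (hu : 1 - u ≠ 0) (hru : 1 + ((r : ℂ) - 1) * u ≠ 0) :
    (1 - u • CyclicWord.relMatrix H.Step).det = H.zetaInv d r u := by
  have hN : H.flagVertex.transpose * (H.flagEdge * H.flagEdge.transpose) * H.flagVertex =
      H.adjMatrix.map (algebraMap ℝ ℂ) + (d : ℂ) • (1 : Matrix V V ℂ) := by
    have h1 : H.flagVertex.transpose * (H.flagEdge * H.flagEdge.transpose) * H.flagVertex =
        H.incMatrix ℂ * (H.incMatrix ℂ).transpose := by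
      rw [← flagVertex_transpose_mul_flagEdge, Matrix.transpose_mul, Matrix.transpose_transpose]
      simp only [Matrix.mul_assoc]
    have h2 : H.incMatrix ℂ = (H.incMatrix ℝ).map (algebraMap ℝ ℂ) := by
      ext v e
      simp only [incMatrix, Matrix.of_apply, Matrix.map_apply]
      split_ifs <;> simp
    rw [h1, h2, ← Matrix.transpose_map, ← Matrix.map_mul, incMatrix_mul_transpose hreg]
    ext v w
    rcases eq_or_ne v w with rfl | h
    · simp
    · simp [h]
  have h := Matrix.det_one_sub_smul_flag H.flagEdge H.flagVertex _ (d : ℂ) (r : ℂ) u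
    (flagEdge_transpose_mul hreg) (flagVertex_transpose_mul hreg) hN hu hru
  rw [← det_one_sub_smul_relMatrix] at h
  have h0 : (1 - u) ^ (Fintype.card V + Fintype.card E) *
      (1 + ((r : ℂ) - 1) * u) ^ Fintype.card V ≠ 0 :=
    mul_ne_zero (pow_ne_zero _ hu) (pow_ne_zero _ hru)
  apply mul_left_cancel₀ h0
  rw [h, zetaInv, ← adjDet]
  have e1 := pow_mul_pow_sub (1 - u) (card_add_card_le_card_flag hreg hdr hr)
  have e2 := pow_mul_pow_sub (1 + ((r : ℂ) - 1) * u) (card_le_card hreg hdr (by omega))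
  rw [← e1, ← e2]
  ring

theorem eventually_hasProd_inv_zetaInv (hreg : H.IsRegular d r) (hdr : r ≤ d) (hr : 2 ≤ r) :
    ∀ᶠ u : ℂ in 𝓝 0, HasProd (fun p : H.PrimeCycle => (1 - u ^ p.length)⁻¹)
      (H.zetaInv d r u)⁻¹ := by
  classical
  have h1 : ∀ᶠ u : ℂ in 𝓝 0, 1 - u ≠ 0 := by
    have hc : ContinuousAt (fun u : ℂ => 1 - u) 0 := by fun_prop
    exact hc.eventually_ne (by simp)
  have h2 : ∀ᶠ u : ℂ in 𝓝 0, 1 + ((r : ℂ) - 1) * u ≠ 0 := by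
    have hc : ContinuousAt (fun u : ℂ => 1 + ((r : ℂ) - 1) * u) 0 := by fun_prop
    exact hc.eventually_ne (by simp)
  filter_upwards [h1, h2, H.eventually_hasProd_primeCycle] with u hu1 hu2 hu3
  rwa [det_one_sub_smul_relMatrix_eq_zetaInv hreg hdr hr hu1 hu2] at hu3

theorem meromorphic_inv_zetaInv : Meromorphic fun u => (H.zetaInv d r u)⁻¹ := fun u =>
  ((H.differentiable_zetaInv d r).analyticAt u).meromorphicAt.inv

theorem isZeta_inv_zetaInv (hreg : H.IsRegular d r) (hdr : r ≤ d) (hr : 2 ≤ r) :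
    H.IsZeta fun u => (H.zetaInv d r u)⁻¹ :=
  ⟨meromorphic_inv_zetaInv, eventually_hasProd_inv_zetaInv hreg hdr hr⟩

/-- By the identity theorem, a meromorphic continuation of the Euler product agrees with
`1 / zetaInv` away from a discrete set. -/
theorem IsZeta.eventuallyEq (hreg : H.IsRegular d r) (hdr : r ≤ d) (hr : 2 ≤ r) {Z : ℂ → ℂ}
    (hZ : H.IsZeta Z) (u : ℂ) : Z =ᶠ[𝓝[≠] u] fun u => (H.zetaInv d r u)⁻¹ := by
  have hmer : Meromorphic (Z - fun u => (H.zetaInv d r u)⁻¹) := fun u =>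
    (hZ.1 u).sub (meromorphic_inv_zetaInv u)
  have h0 : meromorphicOrderAt (Z - fun u => (H.zetaInv d r u)⁻¹) 0 = ⊤ := by
    rw [meromorphicOrderAt_eq_top_iff]
    refine Filter.Eventually.filter_mono nhdsWithin_le_nhds ?_
    filter_upwards [hZ.2, eventually_hasProd_inv_zetaInv hreg hdr hr] with u hu1 hu2
    rw [Pi.sub_apply, hu1.unique hu2, sub_self]
  have hu : meromorphicOrderAt (Z - fun u => (H.zetaInv d r u)⁻¹) u = ⊤ := by
    by_contra hne
    exact hmer.exists_meromorphicOrderAt_ne_top_iff_forall.1 ⟨u, hne⟩ 0 h0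
  filter_upwards [meromorphicOrderAt_eq_top_iff.1 hu] with w hw
  exact sub_eq_zero.1 hw

/-! ### The Riemann hypothesis -/

/-- Removing the factor `(1 + (r - 1) u) ^ (n₂ - n₁)` from `1 / ζ(u)`, `u = q ^ (-s)`, leaves a
function whose zeros in the critical strip are those of `adjDet`. -/
theorem order_pos_iff (hreg : H.IsRegular d r) (hdr : r ≤ d) (hr : 2 ≤ r)
    (hq : 1 < (d - 1) * (r - 1)) {Z : ℂ → ℂ} (hZ : H.IsZeta Z) {s : ℂ} (hs : 0 < s.re) :
    0 < meromorphicOrderAt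
      (fun z : ℂ =>
        (1 + ((r : ℂ) - 1) * (((d - 1) * (r - 1) : ℕ) : ℂ) ^ (-z)) ^
            ((Fintype.card V : ℤ) - (Fintype.card E : ℤ)) /
          Z ((((d - 1) * (r - 1) : ℕ) : ℂ) ^ (-z))) s ↔
      H.adjDet d r ((((d - 1) * (r - 1) : ℕ) : ℂ) ^ (-s)) = 0 := by
  generalize (d - 1) * (r - 1) = q at hq
  have hq0 : (q : ℂ) ≠ 0 := by exact_mod_cast (zero_lt_one.trans hq).ne'
  set φ : ℂ → ℂ := fun z => (q : ℂ) ^ (-z) with hφ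
  have hderiv : ∀ z, HasDerivAt φ (φ z * Complex.log q * (-1)) z := fun z =>
    (hasDerivAt_neg z).const_cpow (Or.inl hq0)
  have hlog := Complex.log_natCast_ne_zero hq
  have htend : Tendsto φ (𝓝[≠] s) (𝓝[≠] φ s) :=
    (hderiv s).tendsto_nhdsNE (mul_ne_zero (mul_ne_zero
      (by simp [hφ, Complex.cpow_eq_zero_iff, hq0]) hlog) (by norm_num))
  set a := Fintype.card H.Flag - (Fintype.card V + Fintype.card E)
  set g : ℂ → ℂ := fun u => (1 - u) ^ a * H.adjDet d r u with hg
  have hgd : Differentiable ℂ g := by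
    have := H.differentiable_adjDet d r
    fun_prop
  have hga : AnalyticAt ℂ (g ∘ φ) s :=
    (hgd.comp fun z => (hderiv z).differentiableAt).analyticAt s
  have hne : ∀ᶠ u in 𝓝[≠] φ s, 1 + ((r : ℂ) - 1) * u ≠ 0 := by
    have hr1 : (r : ℂ) - 1 ≠ 0 := by
      rw [sub_ne_zero]
      exact_mod_cast (by omega : r ≠ 1)
    have hd : HasDerivAt (fun u : ℂ => 1 + ((r : ℂ) - 1) * u) ((r : ℂ) - 1) (φ s) := by
      simpa using ((hasDerivAt_id (φ s)).const_mul ((r : ℂ) - 1)).const_add 1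
    exact hd.eventually_ne hr1
  have hcongr : (fun z : ℂ => (1 + ((r : ℂ) - 1) * φ z) ^
      ((Fintype.card V : ℤ) - (Fintype.card E : ℤ)) / Z (φ z)) =ᶠ[𝓝[≠] s] g ∘ φ := by
    filter_upwards [htend.eventually hne, htend.eventually (hZ.eventuallyEq hreg hdr hr (φ s))]
      with z hz1 hz2
    have hexp : (Fintype.card V : ℤ) - (Fintype.card E : ℤ) =
        -((Fintype.card E - Fintype.card V : ℕ) : ℤ) := by
      have := card_le_card hreg hdr (by omega : 0 < r)
      omega
    rw [hz2, hexp, zpow_neg, zpow_natCast, div_inv_eq_mul, zetaInv, Function.comp_apply, hg]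
    field_simp
    rw [mul_comm]
  have hs1 : 1 - φ s ≠ 0 := by
    intro h
    have h1 : ‖φ s‖ < 1 := by
      rw [hφ, Complex.norm_natCast_cpow_of_pos (zero_lt_one.trans hq)]
      exact Real.rpow_lt_one_of_one_lt_of_neg (by exact_mod_cast hq) (by simpa using hs)
    rw [← sub_eq_zero.1 h] at h1
    simp at h1
  rw [meromorphicOrderAt_congr hcongr, hga.meromorphicOrderAt_pos_iff]
  change (1 - φ s) ^ a * H.adjDet d r (φ s) = 0 ↔ H.adjDet d r (φ s) = 0
  rw [mul_eq_zero, or_iff_right (pow_ne_zero a hs1)]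

/-- In terms of `u = q ^ (-s)`, the Riemann hypothesis says that the zeros of `adjDet` in the
annulus `1 / q < |u| < 1` lie on the circle `|u|² = 1 / q`. -/
theorem modifiedRH_iff (hreg : H.IsRegular d r) (hdr : r ≤ d) (hr : 2 ≤ r)
    (hq : 1 < (d - 1) * (r - 1)) {Z : ℂ → ℂ} (hZ : H.IsZeta Z) :
    H.ModifiedRH d r Z ↔ ∀ u : ℂ, 1 < (((d - 1) * (r - 1) : ℕ) : ℝ) * ‖u‖ → ‖u‖ < 1 →
      H.adjDet d r u = 0 → (((d - 1) * (r - 1) : ℕ) : ℝ) * Complex.normSq u = 1 := by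
  have hord := fun {s : ℂ} (hs : 0 < s.re) => order_pos_iff hreg hdr hr hq hZ hs
  rw [ModifiedRH]
  generalize (d - 1) * (r - 1) = q at hq hord ⊢
  have hq1 : (1 : ℝ) < q := by exact_mod_cast hq
  have hq0 : (0 : ℝ) < q := by linarith
  have hnorm : ∀ s : ℂ, ‖(q : ℂ) ^ (-s)‖ = (q : ℝ) ^ (-s.re) := fun s => by
    rw [Complex.norm_natCast_cpow_of_pos (zero_lt_one.trans hq), Complex.neg_re]
  have hlt1 : ∀ s : ℂ, ‖(q : ℂ) ^ (-s)‖ < 1 ↔ 0 < s.re := fun s => by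
    rw [hnorm, Real.rpow_lt_one_iff_of_pos hq0]
    constructor
    · rintro (h | h) <;> linarith
    · exact fun h => Or.inl ⟨hq1, by linarith⟩
  have hgt : ∀ s : ℂ, 1 < q * ‖(q : ℂ) ^ (-s)‖ ↔ s.re < 1 := fun s => by
    have : (q : ℝ) * (q : ℝ) ^ (-s.re) = (q : ℝ) ^ (1 - s.re) := by
      rw [sub_eq_add_neg, Real.rpow_add hq0, Real.rpow_one]
    rw [hnorm, this, Real.one_lt_rpow_iff_of_pos hq0]
    constructor
    · rintro (h | h) <;> linarith
    · exact fun h => Or.inl ⟨hq1, by linarith⟩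
  have heq : ∀ s : ℂ, q * Complex.normSq ((q : ℂ) ^ (-s)) = 1 ↔ s.re = 1 / 2 := fun s => by
    have h1 : (q : ℝ) * Complex.normSq ((q : ℂ) ^ (-s)) = (q : ℝ) ^ (1 - 2 * s.re) := by
      rw [Complex.normSq_eq_norm_sq, hnorm, ← Real.rpow_natCast, ← Real.rpow_mul hq0.le,
        sub_eq_add_neg, Real.rpow_add hq0, Real.rpow_one]
      congr 2
      push_cast
      ring
    rw [h1, ← Real.rpow_zero (q : ℝ), Real.rpow_right_inj hq0 hq1.ne']
    constructor <;> intro h <;> linarith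
  constructor
  · intro h u hu1 hu2 hu3
    have hu0 : u ≠ 0 := by
      rintro rfl
      simp at hu1
      linarith
    -- `s = - log u / log q` is a preimage of `u`
    obtain ⟨s, rfl⟩ : ∃ s : ℂ, (q : ℂ) ^ (-s) = u := by
      have hqc : (q : ℂ) ≠ 0 := by exact_mod_cast hq0.ne'
      have hlog := Complex.log_natCast_ne_zero hq
      refine ⟨-(Complex.log u / Complex.log q), ?_⟩
      rw [neg_neg, Complex.cpow_def_of_ne_zero hqc, mul_div_cancel₀ _ hlog, Complex.exp_log hu0]
    have h0 := (hlt1 s).1 hu2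
    exact (heq s).2 (h s h0 ((hgt s).1 hu1) ((hord h0).2 hu3))
  · intro h s hs0 hs1 hs
    exact (heq s).1 (h _ ((hgt s).2 hs1) ((hlt1 s).2 hs0) ((hord hs0).1 hs))

end FinHypergraph

theorem mainTheorem1 {V : Type*} {E : Type*} [Fintype V] [Fintype E] [DecidableEq V]
    (H : FinHypergraph V E) (d r : ℕ)
    (hconn : H.Connected) (hreg : H.IsRegular d r)
    (hdr : r ≤ d) (hq : 1 < (d - 1) * (r - 1))
    (hbip : r = 2 → ¬ H.IsBipartite) :
    (∃ Z : ℂ → ℂ, H.IsZeta Z) ∧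
      ∀ Z : ℂ → ℂ, H.IsZeta Z → (H.ModifiedRH d r Z ↔ H.IsRamanujan d r) := by
  have hr : 2 ≤ r := by
    by_contra h
    have : r - 1 = 0 := by omega
    simp [this] at hq
  refine ⟨⟨_, FinHypergraph.isZeta_inv_zetaInv hreg hdr hr⟩, fun Z hZ => ?_⟩
  rw [FinHypergraph.modifiedRH_iff hreg hdr hr hq hZ,
    FinHypergraph.isRamanujan_iff hreg hdr (by omega)]
  have hqcast : (((d - 1) * (r - 1) : ℕ) : ℝ) = ((d : ℝ) - 1) * ((r : ℝ) - 1) := by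
    push_cast [Nat.cast_sub (by omega : 1 ≤ d), Nat.cast_sub (by omega : 1 ≤ r)]
    ring
  have hq1 : 1 < ((d : ℝ) - 1) * ((r : ℝ) - 1) := by
    rw [← hqcast]
    exact_mod_cast hq
  rw [hqcast]
  have habs : ∀ m : ℝ, |m| ≤ 2 * Real.sqrt (((d : ℝ) - 1) * ((r : ℝ) - 1)) ↔
      m ^ 2 ≤ 4 * (((d : ℝ) - 1) * ((r : ℝ) - 1)) := fun m => by
    rw [← sq_le_sq₀ (abs_nonneg m) (by positivity), sq_abs, mul_pow, Real.sq_sqrt (by linarith)]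
    norm_num
  simp only [habs]
  constructor
  · intro hRH t ht hne
    by_contra! hlt
    obtain ⟨a, ha0, ha1, ha2⟩ := exists_quadratic_root hq1 hlt
      (FinHypergraph.abs_lt_of_isRoot_charpoly hconn hreg hdr hq hbip ht hne)
    have hA : |a| < 1 := (sq_lt_one_iff_abs_lt_one a).1 ha2
    have hroot := hRH (a : ℂ) ?_ (by simpa using hA)
      ((H.adjDet_eq_zero_iff d r a).2 ⟨t, ht, by exact_mod_cast ha0⟩)
    · rw [Complex.normSq_ofReal] at hroot
      nlinarith
    · -- `q |a| > q |a|² > 1`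
      rw [Complex.norm_real, Real.norm_eq_abs]
      rw [← sq_abs] at ha1
      nlinarith [abs_nonneg a]
  · intro hRam u hu1 hu2 hu
    obtain ⟨t, ht, hroot⟩ := (H.adjDet_eq_zero_iff d r u).1 hu
    rcases eq_or_ne t (d * (r - 1)) with rfl | hne
    · -- the eigenvalue `d (r - 1)` gives the factor `(1 - u) (1 - q u)`
      exfalso
      have hfac : (1 - u) * (1 - (((d : ℝ) - 1) * ((r : ℝ) - 1) : ℝ) * u) = 0 := by
        push_cast at hroot ⊢
        linear_combination hroot
      rcases mul_eq_zero.1 hfac with h | h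
      · rw [← sub_eq_zero.1 h] at hu2
        simp at hu2
      · have := congrArg norm (sub_eq_zero.1 h)
        rw [norm_mul, Complex.norm_real, norm_one, Real.norm_of_nonneg (by linarith)] at this
        linarith
    · exact Complex.mul_normSq_eq_one_of_quadratic (by linarith) (hRam t ht hne) hroot
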